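/- Let $M$ be a complex manifold of dimension $m$ with holomorphic tangent bundle $\mathcal T_M$, and let $(\mathcal T_M,h,\Phi,\mathcal U,\mathcal Q)$ be an integrable harmonic Higgs bundle with $h$ positive definite. That is: $h$ is a smooth Hermitian metric on $\mathcal T_M$ with Chern connection $D'+\bar\partial$; $\Phi$ is a holomorphic section of $\Omega^1_M\otimes\mathrm{End}(\mathcal T_M)$ with $\Phi\wedge\Phi=0$ such that the connection $D'+\bar\partial+\Phi+\Phi^\dagger$ is integrable, where $\dagger$ is the adjoint with respect to $h$; and $\mathcal U,\mathcal Q$ are $C^\infty$ endomorphisms of $\mathcal T_M$ with $$\bar\partial(\mathcal U)=0,\quad \mathcal Q^\dagger=\mathcal Q,\quad [\Phi,\mathcal U]=0,\quad D'(\mathcal U)-[\Phi,\mathcal Q]+\Phi=0,\quad D'(\mathcal Q)+[\Phi,\mathcal U^\dagger]=0 .$$ Assume that $D'(\mathcal U)=0$ and that $D'$ is a holomorphic connection, i.e. $D'\bar\partial+\bar\partial D'=0$. Set $X\circ Y:=-\Phi_XY$. Then: (1) $X\circ Y=0$ for all $X,Y\in\mathcal T_M$; that is, $\Phi=0$. (2)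 If moreover $\mathcal U=0$, then every point of $M$ has an open neighbourhood with a holomorphic $D'$-flat frame $e_1,\dots,e_m$ of $\mathcal T_M$ and real constants $\lambda_1,\dots,\lambda_m$ such that $\mathcal Qe_i=\lambda_ie_i$ for all $i$, and in this frame, with $\Lambda=\mathrm{diag}(\lambda_1,\dots,\lambda_m)$, for every $w\in\mathbb C$ the structure connection of weight $w$, $$D'+\frac1z\Phi+\Bigl(\frac{\mathcal U}{z}-\mathcal Q-z\,\mathcal U^\dagger+\frac w2\,\mathrm{Id}\Bigr)\frac{dz}{z},$$ on the pull-back of $\mathcal T_M$ to $\mathbb C^*\times M$ (with $D'$ the pulled-back operator, including $\partial_z\,dz$) is equal to $$D'+\Bigl(-\Lambda+\frac w2 I_m\Bigr)\frac{dz}{z}.$$ -/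

import Mathlib

open scoped Manifold ContDiff

/-!
Integrable harmonic Higgs bundles on the holomorphic tangent bundle of a complex manifold `M`.

The manifold is modelled on a finite dimensional complex normed space `E`, and
`TangentSpace 𝓘(ℂ, E) x`, with its complex structure, is the fibre of `T_M` at `x`; it is also the
real tangent space of `M` at `x`.  Therefore a form of type `(1,0)` with values in a complex
vector bundle is a field of `ℂ`-linear maps on the tangent spaces, a form of type `(0,1)` is a
field of conjugate linear maps, and a section that is smooth in the real sense is a section of the
`C^∞` bundle that underlies `T_M`.

Differential operators are written in holomorphic charts: `E` is the coordinate space, and the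
coordinate vector fields of a chart are a holomorphic frame of `T_M`, in which `∂̄` acts
componentwise.
-/

noncomputable section

namespace HarmonicHiggs

/-! ### Operators on an open subset of the coordinate space -/

section Coordinates

variable {E : Type*} [NormedAddCommGroup E] [NormedSpace ℂ E]
  {F : Type*} [NormedAddCommGroup F] [NormedSpace ℂ F]

/-- The `(1,0)` part of the differential: `∂_v f = (df(v) - i df(iv)) / 2`, linear in `v`. -/
def del (f : E → F) (y v : E) : F :=
  (1 / 2 : ℂ) • (fderiv ℝ f y v - Complex.I • fderiv ℝ f y (Complex.I • v))

/-- The `(0,1)` part of the differential: `∂̄_v f = (df(v) + i df(iv)) / 2`, conjugate linear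
in `v`. -/
def delbar (f : E → F) (y v : E) : F :=
  (1 / 2 : ℂ) • (fderiv ℝ f y v + Complex.I • fderiv ℝ f y (Complex.I • v))

/-- The adjoint `A†` of an endomorphism for a nondegenerate sesquilinear form `B`:
`B (A† v) w = B v (A w)`. -/
def adj (B : E →L[ℂ] E →L⋆[ℂ] ℂ) (A : E →L[ℂ] E) : E →L[ℂ] E :=
  B.inverse ∘L
    ((ContinuousLinearMap.compSL E E ℂ (RingHom.id ℂ) (starRingEnd ℂ)).flip A ∘L B)

/-- The connection form `Γ = h⁻¹ ∂h` of the Chern connection of `h` in a holomorphic frame, that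
is `h(Γ_v s, t) = (∂_v h)(s, t)`. -/
def chernForm (h : E → E →L[ℂ] E →L⋆[ℂ] ℂ) (y v : E) : E →L[ℂ] E :=
  (h y).inverse ∘L del h y v

/-- The `(1,0)` part `D' = ∂ + Γ` of the Chern connection, on sections. -/
def dPrime (h : E → E →L[ℂ] E →L⋆[ℂ] ℂ) (s : E → E) (y v : E) : E :=
  del s y v + chernForm h y v (s y)

/-- The `(1,0)` part of the Chern connection on endomorphisms: `D'(A) = ∂A + [Γ, A]`. -/
def dPrimeEnd (h : E → E →L[ℂ] E →L⋆[ℂ] ℂ) (A : E → E →L[ℂ] E) (y v : E) : E →L[ℂ] E :=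
  del A y v + (chernForm h y v ∘L A y - A y ∘L chernForm h y v)

/-- The connection form of `D' + ∂̄ + Φ + Φ†` in the coordinate frame. -/
def totalForm (h : E → E →L[ℂ] E →L⋆[ℂ] ℂ) (Φ : E → E →L[ℂ] E →L[ℂ] E) (y v : E) :
    E →L[ℂ] E :=
  chernForm h y v + Φ y v + adj (h y) (Φ y v)

/-- The curvature `dθ + θ ∧ θ` of the connection `d + θ`, evaluated on `(v, w)`. -/
def curvature (θ : E → E → E →L[ℂ] E) (y v w : E) : E →L[ℂ] E :=
  fderiv ℝ (fun x => θ x w) y v - fderiv ℝ (fun x => θ x v) y w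
    + (θ y v ∘L θ y w - θ y w ∘L θ y v)

/-- The operator `D'` on the pull-back of the bundle to `ℂ* × M` (including `∂_z dz`), applied to
the section `s` at the point `(z, y)` in the direction `(a, v)`. -/
def pullDPrime (h : E → E →L[ℂ] E →L⋆[ℂ] ℂ) (s : ℂ × E → E) (q ξ : ℂ × E) : E :=
  del s q ξ + chernForm h q.2 ξ.2 (s q)

/-- The structure connection (of weight `w`)
`D' + Φ / z + (U / z - Q - z U† + w / 2) dz / z` on the pull-back of the bundle to `ℂ* × M`,
applied to the section `s` at the point `q = (z, y)` in the direction `ξ = (a, v)`. -/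
def structureConn (w : ℂ) (h : E → E →L[ℂ] E →L⋆[ℂ] ℂ) (Φ : E → E →L[ℂ] E →L[ℂ] E)
    (U Q : E → E →L[ℂ] E) (s : ℂ × E → E) (q ξ : ℂ × E) : E :=
  pullDPrime h s q ξ + q.1⁻¹ • Φ q.2 ξ.2 (s q)
    + (ξ.1 / q.1) • (q.1⁻¹ • U q.2 - Q q.2 - q.1 • adj (h q.2) (U q.2)
        + (w / 2) • ContinuousLinearMap.id ℂ E) (s q)

end Coordinates

/-! ### Coordinate expressions in a chart -/

section Charts

variable {E : Type*} [NormedAddCommGroup E] [NormedSpace ℂ E]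
  {M : Type*} [TopologicalSpace M] [ChartedSpace E M]

/-- The tangent map of the inverse of a chart: the coordinate frame at the point with
coordinates `y`. -/
def frameAt (e : OpenPartialHomeomorph M E) (y : E) :
    E →L[ℂ] TangentSpace 𝓘(ℂ, E) (e.symm y) :=
  mfderiv 𝓘(ℂ, E) 𝓘(ℂ, E) e.symm y

/-- The tangent map of a chart at the point with coordinates `y`: the components of a tangent
vector. -/
def coordAt (e : OpenPartialHomeomorph M E) (y : E) :
    TangentSpace 𝓘(ℂ, E) (e.symm y) →L[ℂ] E :=
  mfderiv 𝓘(ℂ, E) 𝓘(ℂ, E) e (e.symm y)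

/-- Coordinate expression of a vector field. -/
def coordSection (e : OpenPartialHomeomorph M E) (s : ∀ x : M, TangentSpace 𝓘(ℂ, E) x) :
    E → E :=
  fun y => coordAt e y (s (e.symm y))

/-- Coordinate expression of a section of the pull-back of `T_M` to `ℂ* × M`. -/
def coordPullSection (e : OpenPartialHomeomorph M E)
    (s : ℂ → ∀ x : M, TangentSpace 𝓘(ℂ, E) x) : ℂ × E → E :=
  fun q => coordSection e (s q.1) q.2

/-- Coordinate expression of a field of endomorphisms of `T_M`. -/
def coordEnd (e : OpenPartialHomeomorph M E)
    (A : ∀ x : M, TangentSpace 𝓘(ℂ, E) x →L[ℂ] TangentSpace 𝓘(ℂ, E) x) : E → E →L[ℂ] E :=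
  fun y => coordAt e y ∘L A (e.symm y) ∘L frameAt e y

/-- Coordinate expression of a `(1,0)`-form with values in the endomorphisms of `T_M`. -/
def coordHiggs (e : OpenPartialHomeomorph M E)
    (Φ : ∀ x : M, TangentSpace 𝓘(ℂ, E) x →L[ℂ]
      TangentSpace 𝓘(ℂ, E) x →L[ℂ] TangentSpace 𝓘(ℂ, E) x) : E → E →L[ℂ] E →L[ℂ] E :=
  fun y => ((ContinuousLinearMap.compL ℂ E E E (coordAt e y)) ∘L
    ((ContinuousLinearMap.compL ℂ E E E).flip (frameAt e y))) ∘L Φ (e.symm y) ∘L frameAt e y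

/-- Coordinate expression of a sesquilinear form on `T_M`. -/
def coordMetric (e : OpenPartialHomeomorph M E)
    (h : ∀ x : M, TangentSpace 𝓘(ℂ, E) x →L[ℂ] TangentSpace 𝓘(ℂ, E) x →L⋆[ℂ] ℂ) :
    E → E →L[ℂ] E →L⋆[ℂ] ℂ :=
  fun y => (ContinuousLinearMap.compSL E E ℂ (RingHom.id ℂ) (starRingEnd ℂ)).flip (frameAt e y)
    ∘L h (e.symm y) ∘L frameAt e y

end Charts

/-! ### Harmonic Higgs bundles on a complex manifold -/

section Manifold

variable {E : Type*} [NormedAddCommGroup E] [NormedSpace ℂ E]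
  {M : Type*} [TopologicalSpace M] [ChartedSpace E M]

/-- `h` is a smooth nondegenerate Hermitian sesquilinear form on `T_M` (linear in the first
argument). -/
structure IsHermitianForm
    (h : ∀ x : M, TangentSpace 𝓘(ℂ, E) x →L[ℂ] TangentSpace 𝓘(ℂ, E) x →L⋆[ℂ] ℂ) : Prop where
  hermitian : ∀ (x : M) (v w : TangentSpace 𝓘(ℂ, E) x), h x v w = starRingEnd ℂ (h x w v)
  nondegenerate : ∀ (x : M) (v : TangentSpace 𝓘(ℂ, E) x), (∀ w, h x v w = 0) → v = 0
  smooth : ∀ e ∈ atlas E M, ContDiffOn ℝ ∞ (coordMetric e h) e.target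

/-- `h` is positive definite. -/
def IsPositiveDefinite
    (h : ∀ x : M, TangentSpace 𝓘(ℂ, E) x →L[ℂ] TangentSpace 𝓘(ℂ, E) x →L⋆[ℂ] ℂ) : Prop :=
  ∀ (x : M) (v : TangentSpace 𝓘(ℂ, E) x), v ≠ 0 → 0 < (h x v v).re

/-- `Φ` is a Higgs field on `T_M`: a holomorphic section of `Ω¹_M ⊗ End(T_M)` with `Φ ∧ Φ = 0`. -/
structure IsHiggsField
    (Φ : ∀ x : M, TangentSpace 𝓘(ℂ, E) x →L[ℂ]
      TangentSpace 𝓘(ℂ, E) x →L[ℂ] TangentSpace 𝓘(ℂ, E) x) : Prop where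
  holomorphic : ∀ e ∈ atlas E M, DifferentiableOn ℂ (coordHiggs e Φ) e.target
  wedge_self : ∀ (x : M) (v w : TangentSpace 𝓘(ℂ, E) x), Φ x v ∘L Φ x w = Φ x w ∘L Φ x v

/-- `(T_M, h, Φ)` is a harmonic Higgs bundle: the connection `D' + ∂̄ + Φ + Φ†` is integrable,
where `D' + ∂̄` is the Chern connection of `h`. -/
structure IsHarmonicHiggsBundle
    (h : ∀ x : M, TangentSpace 𝓘(ℂ, E) x →L[ℂ] TangentSpace 𝓘(ℂ, E) x →L⋆[ℂ] ℂ)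
    (Φ : ∀ x : M, TangentSpace 𝓘(ℂ, E) x →L[ℂ]
      TangentSpace 𝓘(ℂ, E) x →L[ℂ] TangentSpace 𝓘(ℂ, E) x) : Prop where
  metric : IsHermitianForm h
  higgs : IsHiggsField Φ
  integrable : ∀ e ∈ atlas E M, ∀ y ∈ e.target, ∀ v w : E,
    curvature (totalForm (coordMetric e h) (coordHiggs e Φ)) y v w = 0

/-- `(T_M, h, Φ, U, Q)` is an integrable harmonic Higgs bundle: `(T_M, h, Φ)` is a harmonic Higgs
bundle and `U`, `Q` are smooth endomorphisms with `∂̄(U) = 0`, `Q† = Q`, `[Φ, U] = 0`,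
`D'(U) - [Φ, Q] + Φ = 0` and `D'(Q) + [Φ, U†] = 0`. -/
structure IsIntegrableHarmonicHiggsBundle
    (h : ∀ x : M, TangentSpace 𝓘(ℂ, E) x →L[ℂ] TangentSpace 𝓘(ℂ, E) x →L⋆[ℂ] ℂ)
    (Φ : ∀ x : M, TangentSpace 𝓘(ℂ, E) x →L[ℂ]
      TangentSpace 𝓘(ℂ, E) x →L[ℂ] TangentSpace 𝓘(ℂ, E) x)
    (U Q : ∀ x : M, TangentSpace 𝓘(ℂ, E) x →L[ℂ] TangentSpace 𝓘(ℂ, E) x) : Prop where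
  harmonic : IsHarmonicHiggsBundle h Φ
  smooth_U : ∀ e ∈ atlas E M, ContDiffOn ℝ ∞ (coordEnd e U) e.target
  smooth_Q : ∀ e ∈ atlas E M, ContDiffOn ℝ ∞ (coordEnd e Q) e.target
  delbar_U : ∀ e ∈ atlas E M, ∀ y ∈ e.target, ∀ v : E, delbar (coordEnd e U) y v = 0
  selfAdjoint_Q : ∀ (x : M) (v w : TangentSpace 𝓘(ℂ, E) x), h x (Q x v) w = h x v (Q x w)
  comm_U : ∀ (x : M) (v : TangentSpace 𝓘(ℂ, E) x), Φ x v ∘L U x = U x ∘L Φ x v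
  dPrime_U : ∀ e ∈ atlas E M, ∀ y ∈ e.target, ∀ v : E,
    dPrimeEnd (coordMetric e h) (coordEnd e U) y v
      - (coordHiggs e Φ y v ∘L coordEnd e Q y - coordEnd e Q y ∘L coordHiggs e Φ y v)
      + coordHiggs e Φ y v = 0
  dPrime_Q : ∀ e ∈ atlas E M, ∀ y ∈ e.target, ∀ v : E,
    dPrimeEnd (coordMetric e h) (coordEnd e Q) y v
      + (coordHiggs e Φ y v ∘L adj (coordMetric e h y) (coordEnd e U y)
        - adj (coordMetric e h y) (coordEnd e U y) ∘L coordHiggs e Φ y v) = 0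

/-- `D'(A) = 0` for an endomorphism `A` of `T_M`. -/
def DPrimeVanishes
    (h : ∀ x : M, TangentSpace 𝓘(ℂ, E) x →L[ℂ] TangentSpace 𝓘(ℂ, E) x →L⋆[ℂ] ℂ)
    (A : ∀ x : M, TangentSpace 𝓘(ℂ, E) x →L[ℂ] TangentSpace 𝓘(ℂ, E) x) : Prop :=
  ∀ e ∈ atlas E M, ∀ y ∈ e.target, ∀ v : E,
    dPrimeEnd (coordMetric e h) (coordEnd e A) y v = 0

/-- `D'` is a holomorphic connection, `D' ∂̄ + ∂̄ D' = 0`: for constant coordinate fields `v`, `w`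
and smooth sections `s`, the value of `(D' ∂̄ + ∂̄ D') s` on `(v, w̄)` is
`D'_v ∂̄_w s - ∂̄_w D'_v s`. -/
def IsHolomorphicDPrime
    (h : ∀ x : M, TangentSpace 𝓘(ℂ, E) x →L[ℂ] TangentSpace 𝓘(ℂ, E) x →L⋆[ℂ] ℂ) : Prop :=
  ∀ e ∈ atlas E M, ∀ s : E → E, ContDiffOn ℝ ∞ s e.target → ∀ y ∈ e.target, ∀ v w : E,
    dPrime (coordMetric e h) (fun x => delbar s x w) y v
      = delbar (fun x => dPrime (coordMetric e h) s x v) y w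

/-- The product `X ∘ Y = -Φ_X Y` on `T_M`. -/
def higgsProduct
    (Φ : ∀ x : M, TangentSpace 𝓘(ℂ, E) x →L[ℂ]
      TangentSpace 𝓘(ℂ, E) x →L[ℂ] TangentSpace 𝓘(ℂ, E) x)
    (x : M) (X Y : TangentSpace 𝓘(ℂ, E) x) : TangentSpace 𝓘(ℂ, E) x :=
  -(Φ x X Y)

end Manifold

end HarmonicHiggs

end

/-! Vanishing of Φ. Since D'(U) = 0, the equation D'(U) - [Φ, Q] + Φ = 0 becomes [Φ, Q] = Φ. The
(1,1) part of the integrability condition involves ∂̄Γ, ∂̄Φ, D'(Φ†) and [Φ, Φ†], where Γ is the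
Chern form. Here ∂̄Γ = 0 because D' is holomorphic, ∂̄Φ = 0 by assumption, and D'(Φ†) = 0 is the
adjoint of ∂̄Φ = 0 (`apply_dPrimeEnd_eq`). Hence Φ_v commutes with Φ_v†, and tr(Φ_v†Φ_v) =
tr(Φ_v†[Φ_v, Q]) = tr([Φ_v†, Φ_v]Q) = 0. As h is positive definite, Φ_v = 0
(`eq_zero_of_commutator_eq_self`).

The frame. Once Φ = 0, integrability says that the Chern connection is flat, so it has a local
parallel frame A with A(p) = 1 (`exists_parallel_frame`). The frame is holomorphic because Γ is
complex linear in the direction. The remaining equation gives D'(Q) = 0, and self-adjointness turns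
it into ∂̄Q = 0, so Q is parallel and QA = A Q(p). Thus A carries an eigenbasis of the self-adjoint
Q(p) to a flat eigenframe with the same constant real eigenvalues. With U = Φ = 0 only -Q + w/2
survives in the dz/z term, and Q has matrix Λ in this frame. -/

noncomputable section

namespace HarmonicHiggs

open Set Filter Topology Metric

/-! ### Flat connections: parallel frames from linear ODEs along rays. -/

section FlatConnections

variable {E : Type*} [NormedAddCommGroup E] [NormedSpace ℝ E]
  {𝔸 : Type*} [NormedRing 𝔸] [NormedAlgebra ℝ 𝔸]

lemma lipschitzOnWith_neg_mul_left {𝔸 : Type*} [NormedRing 𝔸] {c : 𝔸} {K : NNReal} (hc : ‖c‖ ≤ K) (s : Set 𝔸) :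
    LipschitzOnWith K (fun a => -(c * a)) s := by
  refine LipschitzOnWith.of_dist_le_mul fun a _ b _ => ?_
  rw [dist_neg_neg, dist_eq_norm, dist_eq_norm, ← mul_sub]
  exact (norm_mul_le _ _).trans (by gcongr)

/-- The linear equation `α' = -c α`, `α 0 = 1`, on `[0, 1]` for a small coefficient `c`. -/
lemma exists_linear_ode_solution [CompleteSpace 𝔸] {c : ℝ → 𝔸} (hc : ContinuousOn c (Icc 0 1))
    (hb : ∀ t ∈ Icc (0 : ℝ) 1, ‖c t‖ ≤ 1 / 2) :
    ∃ α : ℝ → 𝔸, α 0 = 1 ∧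
      (∀ t ∈ Icc (0 : ℝ) 1, HasDerivWithinAt α (-(c t * α t)) (Icc 0 1) t) ∧
      ∀ t ∈ Icc (0 : ℝ) 1, ‖α t‖ ≤ ‖(1 : 𝔸)‖ * Real.exp 1 := by
  -- On the ball of radius ‖1‖ about 1 one has ‖a‖ ≤ 2‖1‖, so the bound 1/2 on c keeps the speed
  -- below ‖1‖ and the solution stays in the ball up to time 1. The norm of 1 is not assumed to be
  -- 1.
  have hPL : IsPicardLindelof (fun t a => -(c t * a)) (tmin := 0) (tmax := 1)
      ⟨0, by simp⟩ (1 : 𝔸) ‖(1 : 𝔸)‖₊ 0 ‖(1 : 𝔸)‖₊ 1 := by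
    refine ⟨fun t ht => lipschitzOnWith_neg_mul_left ((hb t ht).trans (by norm_num)) _,
      fun a _ => (hc.mul continuousOn_const).neg, fun t ht a ha => ?_, by simp⟩
    have h1 : ‖a‖ ≤ 2 * ‖(1 : 𝔸)‖ := by
      have h2 : ‖a - 1‖ ≤ ‖(1 : 𝔸)‖ := by simpa [dist_eq_norm] using ha
      have h3 := norm_add_le (a - 1) 1
      rw [sub_add_cancel] at h3
      linarith
    rw [norm_neg]
    calc ‖c t * a‖ ≤ ‖c t‖ * ‖a‖ := norm_mul_le _ _
      _ ≤ 1 / 2 * (2 * ‖(1 : 𝔸)‖) := by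
        gcongr
        exact hb t ht
      _ = ‖(1 : 𝔸)‖₊ := by simp
  obtain ⟨α, h0, hα⟩ := hPL.exists_eq_forall_mem_Icc_hasDerivWithinAt₀
  refine ⟨α, h0, hα, fun t ht => ?_⟩
  have h1 := norm_le_gronwallBound_of_norm_deriv_right_le (δ := ‖(1 : 𝔸)‖) (K := 1) (ε := 0)
    (fun s hs => (hα s hs).continuousWithinAt)
    (fun s hs => (hα s (Ico_subset_Icc_self hs)).mono_of_mem_nhdsWithin
      (Icc_mem_nhdsGE_of_mem hs))
    (le_of_eq (by rw [← h0])) (fun s hs => by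
      rw [norm_neg, add_zero]
      refine (norm_mul_le _ _).trans ?_
      gcongr
      exact (hb s (Ico_subset_Icc_self hs)).trans (by norm_num)) t ht
  rw [gronwallBound_ε0] at h1
  refine h1.trans ?_
  gcongr
  linarith [ht.2]

/-- Two solutions of `α' = -c α` agree, up to a multiple of the error of the first one. -/
lemma dist_linear_ode_le {c : ℝ → 𝔸} (hb : ∀ t ∈ Icc (0 : ℝ) 1, ‖c t‖ ≤ 1) {f f' g : ℝ → 𝔸} {ε : ℝ}
    (hf : ∀ t ∈ Icc (0 : ℝ) 1, HasDerivWithinAt f (f' t) (Icc 0 1) t)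
    (hε : ∀ t ∈ Icc (0 : ℝ) 1, ‖f' t + c t * f t‖ ≤ ε)
    (hg : ∀ t ∈ Icc (0 : ℝ) 1, HasDerivWithinAt g (-(c t * g t)) (Icc 0 1) t)
    (h0 : f 0 = g 0) : ‖f 1 - g 1‖ ≤ ε * (Real.exp 1 - 1) := by
  have h1 := dist_le_of_approx_trajectories_ODE_of_mem (v := fun t a => -(c t * a)) (K := 1)
    (s := fun _ => univ) (εf := ε) (εg := 0) (δ := 0) (a := 0) (b := 1)
    (fun t ht => lipschitzOnWith_neg_mul_left (by simpa using hb t (Ico_subset_Icc_self ht)) _)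
    (fun s hs => (hf s hs).continuousWithinAt)
    (fun s hs => (hf s (Ico_subset_Icc_self hs)).mono_of_mem_nhdsWithin
      (Icc_mem_nhdsGE_of_mem hs))
    (fun s hs => by
      simpa [dist_eq_norm] using hε s (Ico_subset_Icc_self hs))
    (fun _ _ => mem_univ _)
    (fun s hs => (hg s hs).continuousWithinAt)
    (fun s hs => (hg s (Ico_subset_Icc_self hs)).mono_of_mem_nhdsWithin
      (Icc_mem_nhdsGE_of_mem hs))
    (fun s hs => by simp) (fun _ _ => mem_univ _) (by simp [h0]) 1 (by simp)
  rw [dist_eq_norm, gronwallBound_of_K_ne_0 (by simp)] at h1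
  simpa using h1

/-- The data that a `C²` connection form satisfies near a point. -/
lemma exists_ball_bounds {θ : E → E →L[ℝ] 𝔸} {p : E} (hθ : ContDiffAt ℝ 2 θ p) :
    ∃ K : ℝ, 0 ≤ K ∧ ∃ r₀ > 0, (∀ y ∈ ball p r₀, DifferentiableAt ℝ θ y) ∧
      (∀ y ∈ ball p r₀, ‖θ y‖ ≤ K) ∧ (∀ y ∈ ball p r₀, ‖fderiv ℝ θ y‖ ≤ K) ∧
      (∀ y ∈ ball p r₀, ∀ z ∈ ball p r₀, ‖θ z - θ y‖ ≤ K * ‖z - y‖) ∧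
      (∀ y ∈ ball p r₀, ∀ z ∈ ball p r₀,
        ‖θ z - θ y - fderiv ℝ θ y (z - y)‖ ≤ K * ‖z - y‖ * ‖z - y‖) := by
  have h1 : ContDiffAt ℝ 1 (fderiv ℝ θ) p := hθ.fderiv_right (by norm_num)
  obtain ⟨C, s, hs, hC⟩ := h1.exists_lipschitzOnWith
  have e1 : ∀ᶠ y in 𝓝 p, DifferentiableAt ℝ θ y :=
    (hθ.eventually (by simp)).mono fun y hy => hy.differentiableAt (by simp)
  have e2 : ∀ᶠ y in 𝓝 p, ‖θ y‖ < ‖θ p‖ + 1 :=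
    hθ.continuousAt.norm.eventually_lt_const (lt_add_one _)
  have e3 : ∀ᶠ y in 𝓝 p, ‖fderiv ℝ θ y‖ < ‖fderiv ℝ θ p‖ + 1 :=
    ((tendsto_norm (x := fderiv ℝ θ p)).comp h1.continuousAt.tendsto).eventually_lt_const (lt_add_one ‖fderiv ℝ θ p‖)
  obtain ⟨r₀, hr₀, hr⟩ := Metric.eventually_nhds_iff_ball.1 (e1.and (e2.and (e3.and hs)))
  have hK1 : ‖θ p‖ + 1 ≤ (‖θ p‖ + 1) + (‖fderiv ℝ θ p‖ + 1) + C := by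
    have := norm_nonneg (fderiv ℝ θ p); have := C.2; linarith
  have hK2 : ‖fderiv ℝ θ p‖ + 1 ≤ (‖θ p‖ + 1) + (‖fderiv ℝ θ p‖ + 1) + C := by
    have := norm_nonneg (θ p); have := C.2; linarith
  have hK3 : (C : ℝ) ≤ (‖θ p‖ + 1) + (‖fderiv ℝ θ p‖ + 1) + C := by
    have := norm_nonneg (θ p); have := norm_nonneg (fderiv ℝ θ p); linarith
  refine ⟨(‖θ p‖ + 1) + (‖fderiv ℝ θ p‖ + 1) + C, by positivity, r₀, hr₀, fun y hy => (hr y hy).1,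
    fun y hy => (hr y hy).2.1.le.trans hK1, fun y hy => (hr y hy).2.2.1.le.trans hK2,
    fun y hy z hz => ?_, fun y hy z hz => ?_⟩
  · exact (convex_ball p r₀).norm_image_sub_le_of_norm_fderiv_le (fun x hx => (hr x hx).1)
      (fun x hx => (hr x hx).2.2.1.le.trans hK2) hy hz
  · have hseg : segment ℝ y z ⊆ ball p r₀ := (convex_ball p r₀).segment_subset hy hz
    -- On the segment the derivative differs from its value at y by at most C‖z - y‖, which makes
    -- the Taylor remainder quadratic.
    have h2 := (convex_segment y z).norm_image_sub_le_of_norm_fderiv_le'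
      (φ := fderiv ℝ θ y) (C := C * ‖z - y‖)
      (fun x hx => (hr x (hseg hx)).1) (fun x hx => ?_)
      (left_mem_segment ℝ y z) (right_mem_segment ℝ y z)
    · refine h2.trans ?_
      gcongr
    · refine (hC.norm_sub_le (hr x (hseg hx)).2.2.2 (hr y hy).2.2.2).trans ?_
      gcongr
      rw [segment_eq_image'] at hx
      obtain ⟨u, hu, rfl⟩ := hx
      simp only [add_sub_cancel_left, norm_smul, Real.norm_eq_abs, abs_of_nonneg hu.1]
      exact mul_le_of_le_one_left (norm_nonneg _) hu.2

/-- Two parallel sections along the rays of a ball that agree at its centre are equal. -/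
lemma eq_zero_of_parallel {θ : E → E →L[ℝ] 𝔸} {p : E} {r K : ℝ} (hK : ∀ y ∈ ball p r, ‖θ y‖ ≤ K)
    {G : E → 𝔸} (hG : ∀ y ∈ ball p r, ∃ G' : E →L[ℝ] 𝔸, HasFDerivAt G G' y ∧
      ∀ v, G' v = -(θ y v * G y)) (h0 : G p = 0) : ∀ y ∈ ball p r, G y = 0 := by
  intro y hy
  have hmem : ∀ t ∈ Icc (0 : ℝ) 1, p + t • (y - p) ∈ ball p r := fun t ht => by
    rw [mem_ball_iff_norm] at hy ⊢
    rw [add_sub_cancel_left, norm_smul, Real.norm_eq_abs, abs_of_nonneg ht.1]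
    exact (mul_le_of_le_one_left (norm_nonneg _) ht.2).trans_lt hy
  have hd : ∀ t ∈ Icc (0 : ℝ) 1, HasDerivAt (fun t : ℝ => G (p + t • (y - p)))
      (-(θ (p + t • (y - p)) (y - p) * G (p + t • (y - p)))) t := fun t ht => by
    obtain ⟨G', hG', hv⟩ := hG _ (hmem t ht)
    have h1 : HasDerivAt (fun t : ℝ => p + t • (y - p)) (y - p) t := by
      simpa using ((hasDerivAt_id t).smul_const (y - p)).const_add p
    rw [← hv]
    exact hG'.comp_hasDerivAt t h1
  have h1 := eq_zero_of_abs_deriv_le_mul_abs_self_of_eq_zero_right (K := K * ‖y - p‖)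
    (fun t ht => (hd t ht).continuousAt.continuousWithinAt)
    (fun t ht => (hd t (Ico_subset_Icc_self ht)).hasDerivWithinAt) (by simpa using h0)
    (fun t ht => by
      rw [norm_neg]
      refine (norm_mul_le _ _).trans ?_
      gcongr
      exact ((θ _).le_opNorm _).trans
        (by gcongr; exact hK _ (hmem t (Ico_subset_Icc_self ht)))) 1 (by simp)
  simpa using h1

/-- A flat `C²` connection form has a parallel frame near every point. -/
theorem exists_parallel_frame [CompleteSpace 𝔸] {θ : E → E →L[ℝ] 𝔸} {p : E}
    (hθ : ContDiffAt ℝ 2 θ p)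
    (hflat : ∀ᶠ y in 𝓝 p, ∀ v w, fderiv ℝ θ y v w - fderiv ℝ θ y w v
      + (θ y v * θ y w - θ y w * θ y v) = 0) :
    ∃ A : E → 𝔸, A p = 1 ∧ ∀ᶠ y in 𝓝 p, ∃ A' : E →L[ℝ] 𝔸, HasFDerivAt A A' y ∧
      ∀ v, A' v = -(θ y v * A y) := by
  obtain ⟨K, hK0, r₀, hr₀, hdiff, hθK, hDK, hLip, hTay⟩ := exists_ball_bounds hθ
  obtain ⟨r₁, hr₁, hflat⟩ := Metric.eventually_nhds_iff_ball.1 hflat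
  -- K r ≤ 1/2 makes the coefficient along each ray small enough to solve up to time 1; r ≤ 1
  -- absorbs factors ‖x + k‖ below.
  obtain ⟨r, hr, hrr₀, hrr₁, hr1, hKr⟩ :
      ∃ r > 0, r ≤ r₀ ∧ r ≤ r₁ ∧ r ≤ 1 ∧ K * r ≤ 1 / 2 := by
    refine ⟨min (min r₀ r₁) (min 1 (1 / 2 / (K + 1))), by positivity,
      (min_le_left _ _).trans (min_le_left _ _), (min_le_left _ _).trans (min_le_right _ _),
      (min_le_right _ _).trans (min_le_left _ _), ?_⟩
    calc K * min (min r₀ r₁) (min 1 (1 / 2 / (K + 1))) ≤ (K + 1) * (1 / 2 / (K + 1)) := by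
          gcongr
          · linarith
          · exact (min_le_right _ _).trans (min_le_right _ _)
      _ = 1 / 2 := by field_simp
  have hmem : ∀ x : E, ‖x‖ < r → ∀ t ∈ Icc (0 : ℝ) 1, p + t • x ∈ ball p r := fun x hx t ht => by
    rw [mem_ball_iff_norm, add_sub_cancel_left, norm_smul, Real.norm_eq_abs, abs_of_nonneg ht.1]
    exact (mul_le_of_le_one_left (norm_nonneg _) ht.2).trans_lt hx
  have hpath : ∀ (x : E) (t : ℝ), HasDerivAt (fun t : ℝ => p + t • x) x t := fun x t => by
    simpa using ((hasDerivAt_id t).smul_const x).const_add p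
  have hθd : ∀ x : E, ‖x‖ < r → ∀ t ∈ Icc (0 : ℝ) 1, ∀ k : E,
      HasDerivAt (fun t : ℝ => θ (p + t • x) k) (fderiv ℝ θ (p + t • x) x k) t :=
    fun x hx t ht k => by
      have h1 := (hdiff _ (ball_subset_ball hrr₀ (hmem x hx t ht))).hasFDerivAt.comp_hasDerivAt t
        (hpath x t)
      exact (ContinuousLinearMap.apply ℝ 𝔸 k).hasFDerivAt.comp_hasDerivAt t h1
  have hsmall : ∀ x : E, ‖x‖ < r → ∀ t ∈ Icc (0 : ℝ) 1, ‖θ (p + t • x) x‖ ≤ 1 / 2 :=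
    fun x hx t ht => ((θ _).le_opNorm _).trans <| le_trans (by
      gcongr
      exact hθK _ (ball_subset_ball hrr₀ (hmem x hx t ht))) hKr
  have hex : ∀ x : E, ∃ α : ℝ → 𝔸, ‖x‖ < r → α 0 = 1 ∧
      (∀ t ∈ Icc (0 : ℝ) 1, HasDerivWithinAt α (-(θ (p + t • x) x * α t)) (Icc 0 1) t) ∧
      ∀ t ∈ Icc (0 : ℝ) 1, ‖α t‖ ≤ ‖(1 : 𝔸)‖ * Real.exp 1 := fun x => by
    by_cases hx : ‖x‖ < r
    · obtain ⟨α, hα⟩ := exists_linear_ode_solution (c := fun t => θ (p + t • x) x)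
        (fun t ht => (hθd x hx t ht x).continuousAt.continuousWithinAt) (hsmall x hx)
      exact ⟨α, fun _ => hα⟩
    · exact ⟨0, fun h => absurd h hx⟩
  choose α hα using hex
  set N : ℝ := ‖(1 : 𝔸)‖ * Real.exp 1 with hN
  have hN0 : 0 ≤ N := by positivity
  -- The frame at y is parallel transport of 1 along the ray from p to y. At p the ray is constant,
  -- its coefficient is 0, and the solution remains 1.
  refine ⟨fun y => α (y - p) 1, ?_, ?_⟩
  · obtain ⟨h0, hd, -⟩ := hα 0 (by simpa using hr)
    have h1 := dist_linear_ode_le (c := fun _ => 0) (f := fun _ => (1 : 𝔸)) (f' := 0) (g := α 0)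
      (ε := 0) (by simp) (fun t _ => hasDerivWithinAt_const _ _ _) (by simp)
      (fun t ht => by simpa using hd t ht) h0.symm
    rw [zero_mul, norm_le_zero_iff, sub_eq_zero] at h1
    simpa using h1.symm
  filter_upwards [ball_mem_nhds p hr] with y hy
  obtain ⟨x, rfl⟩ : ∃ x, y = p + x := ⟨y - p, by simp⟩
  rw [mem_ball_iff_norm, add_sub_cancel_left] at hy
  simp only [add_sub_cancel_left]
  refine ⟨-((ContinuousLinearMap.mul ℝ 𝔸).flip (α x 1) ∘L θ (p + x)), ?_, fun v => by simp⟩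
  obtain ⟨hx0, hxd, hxN⟩ := hα x hy
  have hev : ∀ᶠ k in 𝓝 (0 : E), ‖x + k‖ < r :=
    (Continuous.tendsto' (by fun_prop) _ _ (by simp)).eventually_lt_const hy
  rw [hasFDerivAt_iff_isLittleO_nhds_zero]
  refine Asymptotics.IsBigO.trans_isLittleO (g := fun k : E => ‖k‖ ^ 2) ?_
    (Asymptotics.isLittleO_norm_pow_id one_lt_two)
  refine Asymptotics.IsBigO.of_bound ((2 * K + 2 * K * K) * N * (Real.exp 1 - 1)) ?_
  filter_upwards [hev] with k hk
  obtain ⟨hk0, hkd, -⟩ := hα (x + k) hk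
  -- The trial function is the expected first-order change of the solution when the ray moves from x
  -- to x + k. It solves the equation of the new ray up to O(‖k‖²), so by Grönwall it differs from
  -- the true solution at t = 1 by O(‖k‖²), which is differentiability.
  have hest := dist_linear_ode_le (c := fun t => θ (p + t • (x + k)) (x + k))
    (f := fun t => α x t - t • (θ (p + t • x) k * α x t))
    (f' := fun t => -(θ (p + t • x) x * α x t)
      - (t • (fderiv ℝ θ (p + t • x) x k * α x t + θ (p + t • x) k * -(θ (p + t • x) x * α x t))
        + (1 : ℝ) • (θ (p + t • x) k * α x t)))
    (g := α (x + k)) (ε := (2 * K + 2 * K * K) * N * ‖k‖ ^ 2)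
    (fun t ht => (hsmall _ hk t ht).trans (by norm_num))
    (fun t ht => (hxd t ht).sub ((hasDerivAt_id t).hasDerivWithinAt.smul
      ((hθd x hy t ht k).hasDerivWithinAt.mul (hxd t ht))))
    ?_ hkd (by simp [hx0, hk0])
  · have e1 : p + x + k - p = x + k := by abel
    simp only [e1, add_sub_cancel_left, one_smul] at hest ⊢
    rw [norm_sub_rev] at hest
    simp only [neg_apply, ContinuousLinearMap.comp_apply,
      ContinuousLinearMap.flip_apply, ContinuousLinearMap.mul_apply', norm_pow, norm_norm]
    calc _ = _ := by congr 1; abel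
      _ ≤ _ := hest
      _ = _ := by ring
  · intro t ht
    have hq := ball_subset_ball hrr₀ (hmem x hy t ht)
    have hq' := ball_subset_ball hrr₀ (hmem _ hk t ht)
    have hfl := hflat _ (ball_subset_ball hrr₁ (hmem x hy t ht)) x k
    have hsub : p + t • (x + k) - (p + t • x) = t • k := by rw [smul_add]; abel
    have hL := hLip _ hq _ hq'
    have hT := hTay _ hq _ hq'
    rw [hsub] at hL hT
    have htk : ‖t • k‖ ≤ ‖k‖ := by
      rw [norm_smul, Real.norm_eq_abs, abs_of_nonneg ht.1]
      exact mul_le_of_le_one_left (norm_nonneg _) ht.2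
    have htn : ‖t‖ ≤ 1 := by rw [Real.norm_eq_abs, abs_of_nonneg ht.1]; exact ht.2
    have hxk : ‖x + k‖ ≤ 1 := hk.le.trans hr1
    set T₀ := θ (p + t • x)
    set T₁ := θ (p + t • (x + k))
    set D := fderiv ℝ θ (p + t • x)
    have hT₀ : ‖T₀‖ ≤ K := hθK _ hq
    have hD : ‖D‖ ≤ K := hDK _ hq
    -- Flatness replaces D x k by D k x minus a commutator. All terms of first order in k then
    -- cancel, and each of the four that remain is quadratic.
    have key : -(T₀ x * α x t) - (t • (D x k * α x t + T₀ k * -(T₀ x * α x t))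
          + (1 : ℝ) • (T₀ k * α x t)) + T₁ (x + k) * (α x t - t • (T₀ k * α x t))
        = (D (t • k) k + (T₁ - T₀ - D (t • k)) (x + k) - t • (T₀ k * T₀ k)
          - t • ((T₁ - T₀) (x + k) * T₀ k)) * α x t := by
      have hfl' : D x k = D k x - (T₀ x * T₀ k - T₀ k * T₀ x) := by
        rw [← sub_eq_zero]; rw [← hfl]; abel
      rw [hfl']
      simp only [map_smul, map_add, sub_apply, smul_apply,
        one_smul, smul_sub, smul_add, add_mul, sub_mul, mul_sub, mul_neg,
        smul_mul_assoc, mul_smul_comm, mul_assoc, smul_neg]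
      abel
    have b1 : ‖D (t • k) k‖ ≤ K * ‖k‖ ^ 2 := by
      calc ‖D (t • k) k‖ ≤ ‖D‖ * ‖t • k‖ * ‖k‖ := D.le_opNorm₂ _ _
        _ ≤ K * ‖k‖ * ‖k‖ := by gcongr
        _ = _ := by ring
    have b2 : ‖(T₁ - T₀ - D (t • k)) (x + k)‖ ≤ K * ‖k‖ ^ 2 := by
      calc _ ≤ ‖T₁ - T₀ - D (t • k)‖ * ‖x + k‖ := ContinuousLinearMap.le_opNorm _ _
        _ ≤ (K * ‖t • k‖ * ‖t • k‖) * 1 := by gcongr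
        _ ≤ (K * ‖k‖ * ‖k‖) * 1 := by gcongr
        _ = _ := by ring
    have b3 : ‖T₀ k‖ ≤ K * ‖k‖ := (T₀.le_opNorm _).trans (by gcongr)
    have b4 : ‖t • (T₀ k * T₀ k)‖ ≤ K * K * ‖k‖ ^ 2 := by
      calc _ ≤ ‖t‖ * ‖T₀ k * T₀ k‖ := norm_smul_le _ _
        _ ≤ 1 * (‖T₀ k‖ * ‖T₀ k‖) := by gcongr; exact norm_mul_le _ _
        _ ≤ 1 * ((K * ‖k‖) * (K * ‖k‖)) := by gcongr
        _ = _ := by ring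
    have b5 : ‖t • ((T₁ - T₀) (x + k) * T₀ k)‖ ≤ K * K * ‖k‖ ^ 2 := by
      calc _ ≤ ‖t‖ * ‖(T₁ - T₀) (x + k) * T₀ k‖ := norm_smul_le _ _
        _ ≤ 1 * (‖(T₁ - T₀) (x + k)‖ * ‖T₀ k‖) := by gcongr; exact norm_mul_le _ _
        _ ≤ 1 * ((‖T₁ - T₀‖ * ‖x + k‖) * ‖T₀ k‖) := by
          gcongr; exact ContinuousLinearMap.le_opNorm _ _
        _ ≤ 1 * (((K * ‖t • k‖) * 1) * (K * ‖k‖)) := by gcongr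
        _ ≤ 1 * (((K * ‖k‖) * 1) * (K * ‖k‖)) := by gcongr
        _ = _ := by ring
    rw [key]
    calc _ ≤ _ * _ := norm_mul_le _ _
      _ ≤ (K * ‖k‖ ^ 2 + K * ‖k‖ ^ 2 + K * K * ‖k‖ ^ 2 + K * K * ‖k‖ ^ 2) * N := by
        gcongr
        · refine (norm_sub_le _ _).trans (add_le_add ((norm_sub_le _ _).trans
            (add_le_add ((norm_add_le _ _).trans (add_le_add b1 b2)) b4)) b5)
        · exact hxN t ht
      _ = _ := by ring

end FlatConnections

/-! ### Real calculus of complex linear and conjugate linear maps. -/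

section SemilinearCalculus

variable {E : Type*} [NormedAddCommGroup E] [NormedSpace ℂ E]
  {F : Type*} [NormedAddCommGroup F] [NormedSpace ℂ F]

/-- Evaluation of continuous semilinear maps is bilinear over the reals. -/
lemma isBoundedBilinearMap_apply_real {σ : ℂ →+* ℂ} [RingHomIsometric σ] :
    IsBoundedBilinearMap ℝ (fun q : (E →SL[σ] F) × E => q.1 q.2) where
  add_left := fun _ _ _ => rfl
  smul_left := fun _ _ _ => rfl
  add_right := fun f => f.map_add
  smul_right := fun c f x => map_real_smul f f.continuous c x
  bound := ⟨1, one_pos, fun f x => by simpa using f.le_opNorm x⟩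

/-- The product rule over ℝ, with σ free so that it serves both the linear and the conjugate linear
slot of a sesquilinear form. -/
lemma fderiv_apply_real {σ : ℂ →+* ℂ} [RingHomIsometric σ] {f : E → E →SL[σ] F} {g : E → E}
    {y : E} (hf : DifferentiableAt ℝ f y) (hg : DifferentiableAt ℝ g y) :
    DifferentiableAt ℝ (fun x => f x (g x)) y ∧
      ∀ v, fderiv ℝ (fun x => f x (g x)) y v = f y (fderiv ℝ g y v) + fderiv ℝ f y v (g y) := by
  have h1 := (isBoundedBilinearMap_apply_real (E := E) (F := F) (σ := σ)).hasFDerivAt (f y, g y)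
  have h2 := h1.comp y (hf.hasFDerivAt.prodMk hg.hasFDerivAt)
  refine ⟨h2.differentiableAt, fun v => ?_⟩
  have h3 := h2.fderiv
  simp only [Function.comp_def] at h3
  rw [h3]
  rfl

lemma contDiff_semilinear {σ : ℂ →+* ℂ} {n : WithTop ℕ∞} (L : E →SL[σ] F) : ContDiff ℝ n L :=
  (AddMonoidHom.toRealLinearMap (L : E →+ F) L.continuous).contDiff

end SemilinearCalculus

/-! ### The operators ∂ and ∂̄, and the type decomposition of curvature. -/

section CoordinateCalculus

variable {E : Type*} [NormedAddCommGroup E] [NormedSpace ℂ E]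
  {F : Type*} [NormedAddCommGroup F] [NormedSpace ℂ F]

lemma fderiv_eq_del_add_delbar (f : E → F) (y v : E) :
    fderiv ℝ f y v = del f y v + delbar f y v := by
  simp only [del, delbar]
  module

lemma del_I_smul (f : E → F) (y v : E) : del f y (Complex.I • v) = Complex.I • del f y v := by
  have hI : Complex.I * (1 / 2 * Complex.I) = -(1 / 2) := by
    linear_combination (1 / 2 : ℂ) * Complex.I_mul_I
  simp only [del, smul_smul, Complex.I_mul_I, neg_smul, one_smul, map_neg, smul_sub, smul_neg, hI]
  module

lemma del_add_dir (f : E → F) (y v w : E) : del f y (v + w) = del f y v + del f y w := by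
  simp only [del, smul_add, map_add]
  module

lemma del_real_smul (f : E → F) (y v : E) (r : ℝ) : del f y (r • v) = r • del f y v := by
  simp only [del, smul_comm Complex.I r v, map_smul, smul_comm _ r, ← smul_sub]

lemma del_congr {f g : E → F} {y : E} (hfg : f =ᶠ[𝓝 y] g) (v : E) : del f y v = del g y v := by
  simp only [del, hfg.fderiv_eq]

lemma del_const (c : F) (y v : E) : del (fun _ => c) y v = 0 := by
  simp [del]

lemma delbar_const (c : F) (y v : E) : delbar (fun _ => c) y v = 0 := by
  simp [delbar]

lemma delbar_eq_zero_of_differentiableAt {f : E → F} {y : E} (hf : DifferentiableAt ℂ f y) (v : E) :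
    delbar f y v = 0 := by
  simp [delbar, hf.fderiv_restrictScalars ℝ, smul_smul]

lemma delbar_add {f g : E → F} {y : E} (hf : DifferentiableAt ℝ f y) (hg : DifferentiableAt ℝ g y)
    (v : E) : delbar (fun x => f x + g x) y v = delbar f y v + delbar g y v := by
  simp only [delbar, fderiv_fun_add hf hg, add_apply]
  module

/-- The Cauchy–Riemann criterion: a real derivative that commutes with i is complex linear. -/
lemma differentiableAt_complex_of_I_smul {f : E → F} {y : E} (hf : DifferentiableAt ℝ f y)
    (hI : ∀ v, fderiv ℝ f y (Complex.I • v) = Complex.I • fderiv ℝ f y v) :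
    DifferentiableAt ℂ f y := by
  let g : E →L[ℂ] F :=
    { toFun := fderiv ℝ f y
      map_add' := map_add _
      map_smul' := fun c v => by
        have h1 : c • v = (c.re : ℂ) • v + (c.im : ℂ) • Complex.I • v := by
          rw [smul_smul, ← add_smul, Complex.re_add_im]
        have h2 : c • fderiv ℝ f y v
            = (c.re : ℂ) • fderiv ℝ f y v + (c.im : ℂ) • Complex.I • fderiv ℝ f y v := by
          rw [smul_smul, ← add_smul, Complex.re_add_im]
        rw [RingHom.id_apply, h1, h2, Complex.coe_smul, Complex.coe_smul,
          Complex.coe_smul, Complex.coe_smul, map_add, map_smul, map_smul, hI]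
      cont := (fderiv ℝ f y).cont }
  have h2 : HasFDerivAt f g y := hasFDerivAt_of_restrictScalars ℝ hf.hasFDerivAt rfl
  exact h2.differentiableAt

lemma delbar_clm_apply {f : E → E →L[ℂ] F} {y : E} (hf : DifferentiableAt ℝ f y) (s v : E) :
    delbar (fun x => f x s) y v = delbar f y v s := by
  have h1 := (fderiv_apply_real hf (differentiableAt_const s)).2
  simp only [delbar, h1]
  simp

lemma contDiffAt_del {f : E → F} {y : E} (hf : ContDiffAt ℝ ∞ f y) (v : E) :
    ContDiffAt ℝ ∞ (fun x => del f x v) y := by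
  have h1 : ContDiffAt ℝ ∞ (fderiv ℝ f) y := hf.fderiv_right (by simp)
  have h2 : ∀ v : E, ContDiffAt ℝ ∞ (fun x => fderiv ℝ f x v) y :=
    fun v => h1.clm_apply contDiffAt_const
  exact ((h2 v).sub ((h2 _).const_smul Complex.I)).const_smul (1 / 2 : ℂ)

/-- The `(1,1)`-part of the curvature of a connection form `P + N` with `P` of type `(1,0)` and `N`
of type `(0,1)`. -/
lemma del_sub_delbar_of_curvature_eq_zero {P N : E → E → E →L[ℂ] E} {y : E}
    (hP : ∀ x v, P x (Complex.I • v) = Complex.I • P x v)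
    (hN : ∀ x v, N x (Complex.I • v) = -(Complex.I • N x v))
    (hPd : ∀ v, DifferentiableAt ℝ (fun x => P x v) y)
    (hNd : ∀ v, DifferentiableAt ℝ (fun x => N x v) y)
    (hc : ∀ v w, curvature (fun x v => P x v + N x v) y v w = 0) (v w : E) :
    del (fun x => N x w) y v - delbar (fun x => P x v) y w
      + (P y v ∘L N y w - N y w ∘L P y v) = 0 := by
  have h1 := hc v w
  have h2 := hc v (Complex.I • w)
  have h3 := hc (Complex.I • v) w
  have h4 := hc (Complex.I • v) (Complex.I • w)
  have d1 : ∀ v, fderiv ℝ (fun x => P x v + N x v) y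
      = fderiv ℝ (fun x => P x v) y + fderiv ℝ (fun x => N x v) y :=
    fun v => fderiv_fun_add (hPd v) (hNd v)
  have d2 : ∀ v, fderiv ℝ (fun x => P x (Complex.I • v)) y
      = Complex.I • fderiv ℝ (fun x => P x v) y :=
    fun v => by simp only [hP]; exact fderiv_fun_const_smul (hPd v) _
  have d3 : ∀ v, fderiv ℝ (fun x => N x (Complex.I • v)) y
      = -(Complex.I • fderiv ℝ (fun x => N x v) y) :=
    fun v => by
      simp only [hN]
      rw [fderiv_fun_neg, ← fderiv_fun_const_smul (hNd v) _]
  simp only [curvature, d1, d2, d3] at h1 h2 h3 h4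
  simp only [hP, hN, add_apply, neg_apply, smul_apply,
    ContinuousLinearMap.comp_add, ContinuousLinearMap.add_comp, ContinuousLinearMap.comp_neg,
    ContinuousLinearMap.neg_comp, ContinuousLinearMap.comp_smul, ContinuousLinearMap.smul_comp]
    at h1 h2 h3 h4
  have k2 := congrArg (Complex.I • ·) h2
  have k3 := congrArg (Complex.I • ·) h3
  simp only [smul_add, smul_sub, smul_neg, smul_smul, Complex.I_mul_I, smul_zero, neg_smul,
    one_smul] at k2 k3 h4
  simp only [del, delbar]
  -- This average over v, iv, w, iw projects onto the part linear in v and conjugate linear in w;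
  -- the (2,0), (0,2) and opposite (1,1) parts cancel.
  linear_combination (norm := module) (1 / 4 : ℂ) • (h1 + k2 - k3 + h4)

end CoordinateCalculus

/-! ### Hermitian forms, adjoints and the Chern form. -/

section Metric

variable {E : Type*} [NormedAddCommGroup E] [NormedSpace ℂ E]

/-- A nondegenerate Hermitian form on a finite dimensional space is invertible. -/
lemma isInvertible_of_nondegenerate [FiniteDimensional ℂ E] {B : E →L[ℂ] E →L⋆[ℂ] ℂ}
    (hB : ∀ v w, B v w = starRingEnd ℂ (B w v)) (hnd : ∀ v, (∀ w, B v w = 0) → v = 0) :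
    B.IsInvertible := by
  -- v ↦ B(·, v) is conjugate linear, so dimensions are counted over ℝ. Conjugation and Hermitian
  -- symmetry then turn its surjectivity into that of B.
  let T : E →ₗ[ℝ] Module.Dual ℂ E :=
    { toFun := fun v => ((B.flip v : E →L[ℂ] ℂ) : E →ₗ[ℂ] ℂ)
      map_add' := fun v w => by ext; simp
      map_smul' := fun r v => by
        ext w
        simpa using map_real_smul (B w) (B w).continuous r v }
  have hT : Function.Injective T := by
    rw [injective_iff_map_eq_zero]
    intro v hv
    refine hnd v fun w => ?_
    rw [hB]
    have h1 : B w v = 0 := LinearMap.congr_fun hv w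
    rw [h1, map_zero]
  have hfr : Module.finrank ℝ E = Module.finrank ℝ (Module.Dual ℂ E) := by
    rw [finrank_real_of_complex, finrank_real_of_complex, Subspace.dual_finrank_eq]
  have hTs : Function.Surjective T :=
    (LinearMap.injective_iff_surjective_of_finrank_eq_finrank hfr).1 hT
  have hbij : Function.Bijective (B : E →ₗ[ℂ] E →L⋆[ℂ] ℂ) := by
    refine ⟨(injective_iff_map_eq_zero _).2 fun v hv => hnd v fun w => ?_, fun ξ => ?_⟩
    · exact DFunLike.congr_fun (F := E →L⋆[ℂ] ℂ) hv w
    · obtain ⟨v, hv⟩ := hTs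
        { toFun := fun w => starRingEnd ℂ (ξ w)
          map_add' := fun a b => by simp
          map_smul' := fun c a => by simp }
      refine ⟨v, ?_⟩
      ext w
      have h1 : B w v = starRingEnd ℂ (ξ w) := LinearMap.congr_fun hv w
      rw [ContinuousLinearMap.coe_coe, hB, h1, Complex.conj_conj]
  exact ⟨(LinearEquiv.ofBijective _ hbij).toContinuousLinearEquiv, by ext; rfl⟩

lemma apply_inverse {B : E →L[ℂ] E →L⋆[ℂ] ℂ} (hB : B.IsInvertible) (φ : E →L⋆[ℂ] ℂ) :
    B (B.inverse φ) = φ := by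
  obtain ⟨e, rfl⟩ := hB
  simp

lemma apply_adj {B : E →L[ℂ] E →L⋆[ℂ] ℂ} (hB : B.IsInvertible) (A : E →L[ℂ] E) (v w : E) :
    B (adj B A v) w = B v (A w) := by
  simp [adj, apply_inverse hB]

lemma apply_chernForm {h : E → E →L[ℂ] E →L⋆[ℂ] ℂ} {y : E} (hB : (h y).IsInvertible) (v s : E) :
    h y (chernForm h y v s) = del h y v s := by
  simp [chernForm, apply_inverse hB]

lemma adj_zero (B : E →L[ℂ] E →L⋆[ℂ] ℂ) : adj B 0 = 0 := by
  ext; simp [adj]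

lemma adj_I_smul (B : E →L[ℂ] E →L⋆[ℂ] ℂ) (A : E →L[ℂ] E) :
    adj B (Complex.I • A) = -(Complex.I • adj B A) := by
  ext; simp [adj]

lemma chernForm_add (h : E → E →L[ℂ] E →L⋆[ℂ] ℂ) (y v w : E) :
    chernForm h y (v + w) = chernForm h y v + chernForm h y w := by
  simp [chernForm, del_add_dir]

lemma chernForm_real_smul (h : E → E →L[ℂ] E →L⋆[ℂ] ℂ) (y v : E) (r : ℝ) :
    chernForm h y (r • v) = r • chernForm h y v := by
  ext s
  simp only [chernForm, del_real_smul, ContinuousLinearMap.comp_apply, smul_apply]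
  exact (h y).inverse.map_smul_of_tower r _

lemma chernForm_I_smul (h : E → E →L[ℂ] E →L⋆[ℂ] ℂ) (y v : E) :
    chernForm h y (Complex.I • v) = Complex.I • chernForm h y v := by
  simp [chernForm, del_I_smul]

/-- If `B` and `C` are adjoint to each other, then so are `D'(B)` and `∂̄(C)`. -/
lemma apply_dPrimeEnd_eq {h : E → E →L[ℂ] E →L⋆[ℂ] ℂ} {B C : E → E →L[ℂ] E} {y : E}
    (hinv : (h y).IsInvertible) (hh : DifferentiableAt ℝ h y)
    (hB : DifferentiableAt ℝ B y) (hC : DifferentiableAt ℝ C y)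
    (hadj : ∀ᶠ x in 𝓝 y, ∀ s t, h x (B x s) t = h x s (C x t)) (v s t : E) :
    h y (dPrimeEnd h B y v s) t = h y s (delbar C y v t) := by
  obtain ⟨dBs, hBs⟩ := fderiv_apply_real hB (differentiableAt_const s)
  obtain ⟨dCt, hCt⟩ := fderiv_apply_real hC (differentiableAt_const t)
  obtain ⟨dhB, hhB⟩ := fderiv_apply_real hh dBs
  obtain ⟨dhs, hhs⟩ := fderiv_apply_real hh (differentiableAt_const s)
  obtain ⟨dl, hl⟩ := fderiv_apply_real dhB (differentiableAt_const t)
  obtain ⟨dr, hr⟩ := fderiv_apply_real dhs dCt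
  have heq : (fun x => h x (B x s) t) =ᶠ[𝓝 y] fun x => h x s (C x t) :=
    hadj.mono fun x hx => hx s t
  have h0 := hadj.self_of_nhds
  have key : ∀ v, h y (fderiv ℝ B y v s) t + fderiv ℝ h y v (B y s) t
      = h y s (fderiv ℝ C y v t) + fderiv ℝ h y v s (C y t) := fun v => by
    have h1 := hl v
    rw [heq.fderiv_eq, hr] at h1
    simp only [hhs, hhB, hBs, hCt] at h1
    simpa using h1.symm
  have h1 := key v
  have h2 := key (Complex.I • v)
  simp only [dPrimeEnd, add_apply, sub_apply, map_add, map_sub,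
    ContinuousLinearMap.comp_apply, apply_chernForm hinv, h0]
  simp only [del, delbar, smul_apply, add_apply, sub_apply, map_smul, map_sub, smul_eq_mul,
    map_smulₛₗ, map_add]
  simp only [map_div₀, map_one, map_ofNat, Complex.conj_I]
  -- This takes the ∂-part of the differentiated identity h(Bs, t) = h(s, Ct). The conjugate linear
  -- slot turns ∂ into ∂̄ on C, and the derivatives of h are the Γ terms of D'(B).
  linear_combination (1 / 2) * h1 - Complex.I / 2 * h2

lemma contDiffAt_comp_real {F G : Type*} [NormedAddCommGroup F] [NormedSpace ℂ F]
    [NormedAddCommGroup G] [NormedSpace ℂ G] {n : WithTop ℕ∞} {y : E}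
    {f : E → F →L[ℂ] G} {g : E → E →L[ℂ] F} (hf : ContDiffAt ℝ n f y) (hg : ContDiffAt ℝ n g y) :
    ContDiffAt ℝ n (fun x => f x ∘L g x) y :=
  ((isBoundedBilinearMap_comp (𝕜 := ℂ) (E := E) (F := F) (G := G)).contDiff.restrict_scalars
    ℝ).contDiffAt.comp y (hf.prodMk hg)

lemma differentiableAt_comp_real {F G : Type*} [NormedAddCommGroup F] [NormedSpace ℂ F]
    [NormedAddCommGroup G] [NormedSpace ℂ G] {y : E}
    {f : E → F →L[ℂ] G} {g : E → E →L[ℂ] F} (hf : DifferentiableAt ℝ f y)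
    (hg : DifferentiableAt ℝ g y) : DifferentiableAt ℝ (fun x => f x ∘L g x) y :=
  DifferentiableAt.comp y (g := fun q : (F →L[ℂ] G) × (E →L[ℂ] F) => q.1 ∘L q.2)
    (((isBoundedBilinearMap_comp (𝕜 := ℂ)).differentiableAt (f y, g y)).restrictScalars ℝ)
    (hf.prodMk hg)

section Smooth

variable [FiniteDimensional ℂ E] {Ω : Set E} {h : E → E →L[ℂ] E →L⋆[ℂ] ℂ}

lemma contDiffAt_inverse {n : WithTop ℕ∞} {y : E} (hh : ContDiffAt ℝ n h y)
    (hinv : (h y).IsInvertible) : ContDiffAt ℝ n (fun x => (h x).inverse) y :=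
  haveI := FiniteDimensional.complete ℂ E
  (hinv.contDiffAt_map_inverse.restrict_scalars ℝ).comp y hh

lemma contDiffAt_chernForm {y : E} (hh : ContDiffAt ℝ ∞ h y)
    (hinv : (h y).IsInvertible) (v : E) : ContDiffAt ℝ ∞ (fun x => chernForm h x v) y := by
  exact contDiffAt_comp_real (contDiffAt_inverse hh hinv) (contDiffAt_del hh v)

lemma differentiableAt_adj {y : E} {A : E → E →L[ℂ] E} (hh : ContDiffAt ℝ ∞ h y)
    (hinv : (h y).IsInvertible) (hA : DifferentiableAt ℝ A y) :
    DifferentiableAt ℝ (fun x => adj (h x) (A x)) y :=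
  differentiableAt_comp_real ((contDiffAt_inverse hh hinv).differentiableAt (by simp))
    (differentiableAt_comp_real (((contDiff_semilinear _).differentiable one_ne_zero _).comp y hA)
      (hh.differentiableAt (by simp)))

end Smooth

end Metric

/-! ### Linear algebra of positive definite Hermitian forms. -/

section PositiveForms

variable {E : Type*} [AddCommGroup E] [Module ℂ E]

/-- The inner product given by a positive definite Hermitian form that is linear in its first
argument. -/
@[reducible] def innerCoreOfForm (B : E →ₗ[ℂ] E →ₗ⋆[ℂ] ℂ)
    (hB : ∀ v w, B v w = starRingEnd ℂ (B w v)) (hpos : ∀ v, v ≠ 0 → 0 < (B v v).re) :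
    InnerProductSpace.Core ℂ E where
  inner v w := B w v
  conj_inner_symm v w := (hB w v).symm
  re_inner_nonneg v := by
    by_cases hv : v = 0
    · simp [hv]
    · exact (hpos v hv).le
  add_left u v w := by simp
  smul_left v w r := by simp
  definite v hv := by
    by_contra hne
    exact (hpos v hne).ne' (by simp [hv])

variable [FiniteDimensional ℂ E] {B : E →ₗ[ℂ] E →ₗ⋆[ℂ] ℂ}

/-- A self-adjoint endomorphism has a basis of eigenvectors with real eigenvalues. -/
lemma exists_eigenbasis (hB : ∀ v w, B v w = starRingEnd ℂ (B w v))
    (hpos : ∀ v, v ≠ 0 → 0 < (B v v).re) (Q : E →ₗ[ℂ] E) (hQ : ∀ v w, B (Q v) w = B v (Q w)) :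
    ∃ (b : Module.Basis (Fin (Module.finrank ℂ E)) ℂ E) (l : Fin (Module.finrank ℂ E) → ℝ),
      ∀ i, Q (b i) = (l i : ℂ) • b i := by
  -- E has no norm in this section, so the form can supply it. The inner product swaps the arguments
  -- of B, hence the swap in `hsym`.
  let := (innerCoreOfForm B hB hpos).toNormedAddCommGroup
  let := InnerProductSpace.ofCore (innerCoreOfForm B hB hpos).toCore
  have hsym : Q.IsSymmetric := fun v w => (hQ w v).symm
  exact ⟨(hsym.eigenvectorBasis rfl).toBasis, hsym.eigenvalues rfl, fun i => by
    rw [OrthonormalBasis.coe_toBasis]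
    exact hsym.apply_eigenvectorBasis rfl i⟩

/-- An endomorphism `A` with `[A, Q] = A` that commutes with its adjoint vanishes. -/
lemma eq_zero_of_commutator_eq_self (hB : ∀ v w, B v w = starRingEnd ℂ (B w v))
    (hpos : ∀ v, v ≠ 0 → 0 < (B v v).re) {A N Q : E →ₗ[ℂ] E} (hN : ∀ v w, B (N v) w = B v (A w))
    (hcomm : A * N = N * A) (hAQ : A * Q - Q * A = A) : A = 0 := by
  let := (innerCoreOfForm B hB hpos).toNormedAddCommGroup
  let := InnerProductSpace.ofCore (innerCoreOfForm B hB hpos).toCore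
  have htr : LinearMap.trace ℂ E (N * A) = 0 := by
    calc LinearMap.trace ℂ E (N * A) = LinearMap.trace ℂ E (N * A * Q - N * Q * A) := by
          rw [mul_assoc N, mul_assoc N, ← mul_sub, hAQ]
      _ = 0 := by
        rw [map_sub, LinearMap.trace_mul_cycle ℂ N Q A, hcomm, sub_self]
  let b := stdOrthonormalBasis ℂ E
  rw [LinearMap.trace_eq_sum_inner _ b] at htr
  -- N is the adjoint of A, so tr(NA) is the sum of the ‖A bᵢ‖² and its vanishing kills A on a
  -- basis.
  have hin : ∀ v, inner ℂ v ((N * A) v) = ((‖A v‖ ^ 2 : ℝ) : ℂ) := fun v => by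
    have h1 : inner ℂ v ((N * A) v) = inner ℂ (A v) (A v) := hN (A v) v
    rw [h1, inner_self_eq_norm_sq_to_K]
    simp
  simp only [hin] at htr
  rw [← Complex.ofReal_sum, Complex.ofReal_eq_zero,
    Finset.sum_eq_zero_iff_of_nonneg (fun i _ => by positivity)] at htr
  refine b.toBasis.ext fun i => ?_
  simpa using htr i (Finset.mem_univ i)

end PositiveForms

/-! ### Both claims on an open subset of the coordinate space. -/

section CoordinateTheorems

variable {E : Type*} [NormedAddCommGroup E] [NormedSpace ℂ E] [FiniteDimensional ℂ E]
  {Ω : Set E} {h : E → E →L[ℂ] E →L⋆[ℂ] ℂ} {Φ : E → E →L[ℂ] E →L[ℂ] E} {Q : E → E →L[ℂ] E}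

/-- The underlying algebraic form. -/
def algForm (B : E →L[ℂ] E →L⋆[ℂ] ℂ) : E →ₗ[ℂ] E →ₗ⋆[ℂ] ℂ where
  toFun v := (B v : E →ₗ⋆[ℂ] ℂ)
  map_add' v w := by ext; simp
  map_smul' c v := by ext; simp

lemma isInvertible_of_pos {B : E →L[ℂ] E →L⋆[ℂ] ℂ} (hB : ∀ v w, B v w = starRingEnd ℂ (B w v))
    (hpos : ∀ v, v ≠ 0 → 0 < (B v v).re) : B.IsInvertible :=
  isInvertible_of_nondegenerate hB fun v hv => by
    by_contra hne
    exact (hpos v hne).ne' (by simp [hv])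

/-- A Higgs field with `[Φ, Q] = Φ` in a harmonic bundle with holomorphic `D'` vanishes. -/
theorem higgs_eq_zero_of_coord (hΩ : IsOpen Ω) (hh : ContDiffOn ℝ ∞ h Ω)
    (hherm : ∀ y ∈ Ω, ∀ v w, h y v w = starRingEnd ℂ (h y w v))
    (hpos : ∀ y ∈ Ω, ∀ v, v ≠ 0 → 0 < (h y v v).re)
    (hΦ : DifferentiableOn ℂ Φ Ω)
    (hint : ∀ y ∈ Ω, ∀ v w, curvature (totalForm h Φ) y v w = 0)
    (hhol : ∀ s : E → E, ContDiffOn ℝ ∞ s Ω → ∀ y ∈ Ω, ∀ v w,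
      dPrime h (fun x => delbar s x w) y v = delbar (fun x => dPrime h s x v) y w)
    (hΦQ : ∀ y ∈ Ω, ∀ v, Φ y v ∘L Q y - Q y ∘L Φ y v = Φ y v) :
    ∀ y ∈ Ω, Φ y = 0 := by
  intro y hy
  have hnhds := hΩ.mem_nhds hy
  have hinv : ∀ x ∈ Ω, (h x).IsInvertible := fun x hx => isInvertible_of_pos (hherm x hx) (hpos x hx)
  have hhc : ContDiffAt ℝ ∞ h y := hh.contDiffAt hnhds
  have hhd : DifferentiableAt ℝ h y := hhc.differentiableAt (by simp)
  have hΦd : DifferentiableAt ℂ Φ y := (hΦ y hy).differentiableAt hnhds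
  have hΦdv : ∀ v, DifferentiableAt ℂ (fun x => Φ x v) y :=
    fun v => hΦd.clm_apply (differentiableAt_const v)
  have hΦr : ∀ v, DifferentiableAt ℝ (fun x => Φ x v) y := fun v => (hΦdv v).restrictScalars ℝ
  have hΓ : ∀ v, DifferentiableAt ℝ (fun x => chernForm h x v) y :=
    fun v => (contDiffAt_chernForm hhc (hinv y hy) v).differentiableAt (by simp)
  have hN : ∀ v, DifferentiableAt ℝ (fun x => adj (h x) (Φ x v)) y :=
    fun v => differentiableAt_adj hhc (hinv y hy) (hΦr v)
  -- On a constant section s, D'∂̄s = ∂̄D's reads 0 = ∂̄(Γs).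
  have hΓbar : ∀ v w, delbar (fun x => chernForm h x v) y w = 0 := fun v w => by
    ext s
    have h1 := hhol (fun _ => s) contDiffOn_const y hy v w
    simp only [dPrime, delbar_const, del_const, map_zero, add_zero, zero_add] at h1
    rw [← delbar_clm_apply (hΓ v), ← h1]
    simp
  ext1 v
  have h11 := del_sub_delbar_of_curvature_eq_zero (P := fun x v => chernForm h x v + Φ x v)
    (N := fun x v => adj (h x) (Φ x v)) (y := y)
    (fun x v => by simp [chernForm_I_smul]) (fun x v => by simp [adj_I_smul])
    (fun v => (hΓ v).add (hΦr v)) hN (hint y hy) v v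
  rw [delbar_add (hΓ v) (hΦr v), hΓbar, delbar_eq_zero_of_differentiableAt (hΦdv v), add_zero,
    sub_zero] at h11
  have hD : dPrimeEnd h (fun x => adj (h x) (Φ x v)) y v = 0 := by
    ext s
    refine (injective_iff_map_eq_zero (h y)).1 ?_ _ ?_
    · obtain ⟨e, he⟩ := hinv y hy
      rw [← he]
      exact e.injective
    · ext t
      rw [apply_dPrimeEnd_eq (hinv y hy) hhd (hN v) (hΦr v)
        (by filter_upwards [hnhds] with x hx using fun s t => apply_adj (hinv x hx) _ s t),
        delbar_eq_zero_of_differentiableAt (hΦdv v)]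
      simp
  -- Subtracting D'(Φ†) = ∂Φ† + [Γ, Φ†] = 0 from the (1,1) curvature leaves [Φ, Φ†] = 0.
  have hcomm : Φ y v ∘L adj (h y) (Φ y v) = adj (h y) (Φ y v) ∘L Φ y v := by
    rw [← sub_eq_zero, ← h11]
    rw [dPrimeEnd] at hD
    rw [ContinuousLinearMap.add_comp, ContinuousLinearMap.comp_add]
    rw [eq_sub_of_add_eq hD]
    abel
  have hzero := eq_zero_of_commutator_eq_self (B := algForm (h y)) (hherm y hy) (hpos y hy)
    (A := (Φ y v : E →ₗ[ℂ] E)) (N := (adj (h y) (Φ y v) : E →ₗ[ℂ] E)) (Q := (Q y : E →ₗ[ℂ] E))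
    (fun s t => apply_adj (hinv y hy) _ s t)
    (by ext s; exact DFunLike.congr_fun hcomm s)
    (by ext s; exact DFunLike.congr_fun (hΦQ y hy v) s)
  ext s
  exact LinearMap.congr_fun hzero s

/-- A flat holomorphic eigenframe in coordinates. -/
theorem exists_flat_eigenframe_of_coord (hΩ : IsOpen Ω) (hh : ContDiffOn ℝ ∞ h Ω)
    (hherm : ∀ y ∈ Ω, ∀ v w, h y v w = starRingEnd ℂ (h y w v))
    (hpos : ∀ y ∈ Ω, ∀ v, v ≠ 0 → 0 < (h y v v).re)
    (hflat : ∀ y ∈ Ω, ∀ v w, curvature (chernForm h) y v w = 0)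
    (hQc : ContDiffOn ℝ ∞ Q Ω) (hQ : ∀ y ∈ Ω, ∀ v w, h y (Q y v) w = h y v (Q y w))
    (hDQ : ∀ y ∈ Ω, ∀ v, dPrimeEnd h Q y v = 0) {p : E} (hp : p ∈ Ω) :
    ∃ r > 0, ball p r ⊆ Ω ∧ ∃ (b : E → Module.Basis (Fin (Module.finrank ℂ E)) ℂ E)
      (l : Fin (Module.finrank ℂ E) → ℝ),
      (∀ i, DifferentiableOn ℂ (fun y => b y i) (ball p r)) ∧
      (∀ i, ∀ y ∈ ball p r, ∀ v, dPrime h (fun y => b y i) y v = 0) ∧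
      ∀ y ∈ ball p r, ∀ i, Q y (b y i) = (l i : ℂ) • b y i := by
  have := FiniteDimensional.complete ℂ E
  have hinv : ∀ x ∈ Ω, (h x).IsInvertible := fun x hx => isInvertible_of_pos (hherm x hx) (hpos x hx)
  have hhc : ∀ y ∈ Ω, ContDiffAt ℝ ∞ h y := fun y hy => hh.contDiffAt (hΩ.mem_nhds hy)
  -- The Chern form bundled as a real 1-form with values in the Banach algebra of endomorphisms.
  let θ : E → E →L[ℝ] E →L[ℂ] E := fun y => LinearMap.toContinuousLinearMap
    { toFun := chernForm h y
      map_add' := chernForm_add h y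
      map_smul' := fun r v => chernForm_real_smul h y v r }
  have hθv : ∀ v, (fun y => θ y v) = fun y => chernForm h y v := fun v => rfl
  have hθ : ContDiffOn ℝ ∞ θ Ω := contDiffOn_clm_apply.2 fun v y hy =>
    (contDiffAt_chernForm (hhc y hy) (hinv y hy) v).contDiffWithinAt
  have hθp : ContDiffAt ℝ 2 θ p := contDiffAt_infty.1 (hθ.contDiffAt (hΩ.mem_nhds hp)) 2
  have hθflat : ∀ᶠ y in 𝓝 p, ∀ v w, fderiv ℝ θ y v w - fderiv ℝ θ y w v
      + (θ y v * θ y w - θ y w * θ y v) = 0 := by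
    filter_upwards [hΩ.mem_nhds hp] with y hy v w
    have h1 : DifferentiableAt ℝ θ y := (hθ.contDiffAt (hΩ.mem_nhds hy)).differentiableAt (by simp)
    have h2 : ∀ v w, fderiv ℝ (fun x => chernForm h x w) y v = fderiv ℝ θ y v w := fun v w => by
      rw [← hθv, fderiv_clm_apply h1 (differentiableAt_const w)]
      simp
    have h3 := hflat y hy v w
    rw [curvature, h2, h2] at h3
    exact h3
  obtain ⟨A, hAp, hA⟩ := exists_parallel_frame hθp hθflat
  have hAunit : ∀ᶠ y in 𝓝 p, IsUnit (A y) := by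
    obtain ⟨A', hA', -⟩ := hA.self_of_nhds
    exact hA'.continuousAt.eventually (by
      rw [hAp]
      exact Units.isOpen.mem_nhds isUnit_one)
  obtain ⟨K, -, r₀, hr₀, -, hK, -⟩ := exists_ball_bounds hθp
  have hnear : ∀ᶠ y in 𝓝 p, y ∈ ball p r₀ ∧ y ∈ Ω :=
    inter_mem (ball_mem_nhds p hr₀) (hΩ.mem_nhds hp)
  obtain ⟨r, hr, hball⟩ := Metric.eventually_nhds_iff_ball.1
    ((hA.and hAunit).and hnear)
  obtain ⟨b₀, l, hl⟩ := exists_eigenbasis (B := algForm (h p)) (hherm p hp) (hpos p hp)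
    (Q p : E →ₗ[ℂ] E) (hQ p hp)
  have hDQ' : ∀ y ∈ Ω, ∀ v, fderiv ℝ Q y v = Q y ∘L θ y v - θ y v ∘L Q y := fun y hy v => by
    have hQd : DifferentiableAt ℝ Q y :=
      (hQc.contDiffAt (hΩ.mem_nhds hy)).differentiableAt (by simp)
    -- Q is its own adjoint, so h(∂̄Q t, ∂̄Q t) = h(D'(Q)(∂̄Q t), t) = 0.
    have h1 : delbar Q y v = 0 := by
      ext t
      by_contra hne
      refine (hpos y hy _ hne).ne' ?_
      rw [← apply_dPrimeEnd_eq (hinv y hy) ((hhc y hy).differentiableAt (by simp)) hQd hQd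
        (by filter_upwards [hΩ.mem_nhds hy] with x hx using hQ x hx), hDQ y hy]
      simp
    have h2 := hDQ y hy v
    rw [fderiv_eq_del_add_delbar, h1, add_zero]
    rw [dPrimeEnd, add_eq_zero_iff_eq_neg, neg_sub] at h2
    exact h2
  -- QA and A Q(p) satisfy the same parallel equation and agree at p.
  have hQA : ∀ y ∈ ball p r, Q y * A y = A y * Q p := by
    have h0 := eq_zero_of_parallel (θ := θ) (p := p) (r := r) (K := K)
      (fun y hy => hK y (hball y hy).2.1) (G := fun y => Q y * A y - A y * Q p) (fun y hy => by
        obtain ⟨⟨⟨A', hA', hv⟩, -⟩, -, hyΩ⟩ := hball y hy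
        have hQd : HasFDerivAt Q (fderiv ℝ Q y) y :=
          ((hQc.contDiffAt (hΩ.mem_nhds hyΩ)).differentiableAt (by simp)).hasFDerivAt
        refine ⟨_, (hQd.mul' hA').sub (hA'.mul_const' (Q p)), fun v => ?_⟩
        have h1 : fderiv ℝ Q y v = Q y * θ y v - θ y v * Q y := hDQ' y hyΩ v
        simp only [sub_apply, add_apply, smul_apply, smul_eq_mul, MulOpposite.smul_eq_mul_unop,
          MulOpposite.unop_op, hv, h1]
        noncomm_ring) (by simp [hAp])
    exact fun y hy => sub_eq_zero.1 (h0 y hy)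
  have hb : ∀ y, ∃ b : Module.Basis (Fin (Module.finrank ℂ E)) ℂ E,
      IsUnit (A y) → ∀ i, b i = A y (b₀ i) := fun y => by
    by_cases hu : IsUnit (A y)
    · obtain ⟨u, hu'⟩ := hu
      refine ⟨b₀.map (ContinuousLinearEquiv.unitsEquiv ℂ E u).toLinearEquiv, fun _ i => ?_⟩
      rw [← hu']
      simp
    · exact ⟨b₀, fun h => absurd h hu⟩
  choose b hb using hb
  have hder : ∀ y ∈ ball p r, ∀ i, DifferentiableAt ℝ (fun y => b y i) y ∧
      ∀ v, fderiv ℝ (fun y => b y i) y v = -(chernForm h y v (b y i)) := fun y hy i => by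
    obtain ⟨⟨⟨A', hA', hv⟩, -⟩, -, hyΩ⟩ := hball y hy
    obtain ⟨h1, h2⟩ := fderiv_apply_real hA'.differentiableAt (differentiableAt_const (b₀ i))
    have heq : (fun y => b y i) =ᶠ[𝓝 y] fun y => A y (b₀ i) := by
      filter_upwards [isOpen_ball.mem_nhds hy] with x hx using hb x (hball x hx).1.2 i
    refine ⟨h1.congr_of_eventuallyEq heq, fun v => ?_⟩
    rw [heq.fderiv_eq, h2, hA'.fderiv, hv, hb y (hball y hy).1.2 i]
    simp [θ]
  refine ⟨r, hr, fun y hy => (hball y hy).2.2, b, l, fun i y hy => ?_, fun i y hy v => ?_,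
    fun y hy i => ?_⟩
  · obtain ⟨h1, h2⟩ := hder y hy i
    exact (differentiableAt_complex_of_I_smul h1 fun v => by
      simp [h2, chernForm_I_smul]).differentiableWithinAt
  -- The derivative -Γb is complex linear in v, so it equals ∂b and cancels the Γ term of D'.
  · obtain ⟨-, h2⟩ := hder y hy i
    simp only [dPrime, del, h2, chernForm_I_smul, smul_apply, smul_neg, smul_smul,
      Complex.I_mul_I]
    module
  · rw [hb y (hball y hy).1.2 i]
    have h1 := DFunLike.congr_fun (hQA y hy) (b₀ i)
    have h2 : Q p (b₀ i) = (l i : ℂ) • b₀ i := hl i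
    simp only [mul_apply_eq_comp, h2, map_smul] at h1
    exact h1

end CoordinateTheorems

/-! ### Passage between bundle data and coordinate expressions. -/

section CoordinateExpressions

variable {E : Type*} [NormedAddCommGroup E] [NormedSpace ℂ E]
  {M : Type*} [TopologicalSpace M] [ChartedSpace E M]
  {h : ∀ x : M, TangentSpace 𝓘(ℂ, E) x →L[ℂ] TangentSpace 𝓘(ℂ, E) x →L⋆[ℂ] ℂ}
  {Φ : ∀ x : M, TangentSpace 𝓘(ℂ, E) x →L[ℂ]
      TangentSpace 𝓘(ℂ, E) x →L[ℂ] TangentSpace 𝓘(ℂ, E) x}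
  {U : ∀ x : M, TangentSpace 𝓘(ℂ, E) x →L[ℂ] TangentSpace 𝓘(ℂ, E) x}
  {e : OpenPartialHomeomorph M E}

lemma coordMetric_hermitian (hh : IsHermitianForm h) (y v w : E) :
    coordMetric e h y v w = starRingEnd ℂ (coordMetric e h y w v) :=
  hh.hermitian _ _ _

lemma coordHiggs_zero (hΦ : ∀ x, Φ x = 0) : coordHiggs e Φ = 0 := by
  ext y v w
  change coordAt e y (Φ _ (frameAt e y v) (frameAt e y w)) = 0
  rw [hΦ]
  exact map_zero (coordAt e y)

lemma coordEnd_zero (hU : ∀ x, U x = 0) : coordEnd e U = 0 := by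
  ext y v
  change coordAt e y (U _ (frameAt e y v)) = 0
  rw [hU]
  exact map_zero (coordAt e y)

end CoordinateExpressions

section Coordinates

variable {E : Type*} [NormedAddCommGroup E] [NormedSpace ℂ E]
  {M : Type*} [TopologicalSpace M] [ChartedSpace E M] [IsManifold 𝓘(ℂ, E) ω M]
  {e : OpenPartialHomeomorph M E} {y : E}

lemma coordAt_frameAt (he : e ∈ atlas E M) (hy : y ∈ e.target) (v : E) :
    coordAt e y (frameAt e y v) = v := by
  have : IsManifold 𝓘(ℂ, E) 1 M := IsManifold.of_le (n := ω) le_top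
  exact DFunLike.congr_fun
    ((mdifferentiable_of_mem_atlas (I := 𝓘(ℂ, E)) he).comp_symm_deriv hy) v

lemma frameAt_injective (he : e ∈ atlas E M) (hy : y ∈ e.target) :
    Function.Injective (frameAt e y) :=
  Function.LeftInverse.injective (g := coordAt e y) (coordAt_frameAt he hy)

variable [FiniteDimensional ℂ E]

/-- In finite dimension a one-sided inverse of an endomorphism is two-sided; the tangent space is
definitionally E. -/
lemma frameAt_coordAt (he : e ∈ atlas E M) (hy : y ∈ e.target)
    (X : TangentSpace 𝓘(ℂ, E) (e.symm y)) : frameAt e y (coordAt e y X) = X := by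
  let C : E →ₗ[ℂ] E := (coordAt e y).toLinearMap
  let D : E →ₗ[ℂ] E := (frameAt e y).toLinearMap
  have h1 : C * D = 1 := LinearMap.ext fun v => coordAt_frameAt he hy v
  exact LinearMap.congr_fun (mul_eq_one_comm.1 h1) X

lemma coordAt_injective (he : e ∈ atlas E M) (hy : y ∈ e.target) :
    Function.Injective (coordAt e y) :=
  Function.LeftInverse.injective (g := frameAt e y) (frameAt_coordAt he hy)

/-- A basis of a tangent space with prescribed components. -/
lemma exists_basis_coordAt {ι : Type*} (he : e ∈ atlas E M) (hy : y ∈ e.target)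
    (b : Module.Basis ι ℂ E) :
    ∃ b' : Module.Basis ι ℂ (TangentSpace 𝓘(ℂ, E) (e.symm y)), ∀ i, coordAt e y (b' i) = b i := by
  let T : E ≃ₗ[ℂ] TangentSpace 𝓘(ℂ, E) (e.symm y) :=
    { (frameAt e y).toLinearMap with
      invFun := coordAt e y
      left_inv := coordAt_frameAt he hy
      right_inv := frameAt_coordAt he hy }
  exact ⟨b.map T, fun i => by
    rw [Module.Basis.map_apply]
    exact coordAt_frameAt he hy (b i)⟩

end Coordinates

/-! ### Vanishing of the Higgs field on the manifold. -/

section HarmonicBundles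

variable {E : Type*} [NormedAddCommGroup E] [NormedSpace ℂ E]
  {M : Type*} [TopologicalSpace M] [ChartedSpace E M] [IsManifold 𝓘(ℂ, E) ω M]
  {h : ∀ x : M, TangentSpace 𝓘(ℂ, E) x →L[ℂ] TangentSpace 𝓘(ℂ, E) x →L⋆[ℂ] ℂ}
  {Φ : ∀ x : M, TangentSpace 𝓘(ℂ, E) x →L[ℂ]
      TangentSpace 𝓘(ℂ, E) x →L[ℂ] TangentSpace 𝓘(ℂ, E) x}
  {U Q : ∀ x : M, TangentSpace 𝓘(ℂ, E) x →L[ℂ] TangentSpace 𝓘(ℂ, E) x}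
  {e : OpenPartialHomeomorph M E}

lemma coordMetric_pos (hpos : IsPositiveDefinite h) (he : e ∈ atlas E M) {y : E}
    (hy : y ∈ e.target) {v : E} (hv : v ≠ 0) : 0 < (coordMetric e h y v v).re :=
  hpos _ _ fun h0 => hv (frameAt_injective he hy (h0.trans (map_zero _).symm))

variable [FiniteDimensional ℂ E]

lemma coordMetric_selfAdjoint (hQ : ∀ (x : M) (v w : TangentSpace 𝓘(ℂ, E) x),
    h x (Q x v) w = h x v (Q x w)) (he : e ∈ atlas E M) {y : E} (hy : y ∈ e.target) (v w : E) :
    coordMetric e h y (coordEnd e Q y v) w = coordMetric e h y v (coordEnd e Q y w) := by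
  have h1 : ∀ v, frameAt e y (coordEnd e Q y v) = Q _ (frameAt e y v) :=
    fun v => frameAt_coordAt he hy _
  change h _ (frameAt e y (coordEnd e Q y v)) (frameAt e y w)
    = h _ (frameAt e y v) (frameAt e y (coordEnd e Q y w))
  rw [h1, h1, hQ]

theorem higgs_eq_zero (hI : IsIntegrableHarmonicHiggsBundle h Φ U Q) (hpos : IsPositiveDefinite h)
    (hDU : DPrimeVanishes h U) (hD : IsHolomorphicDPrime h) (x : M) : Φ x = 0 := by
  have he := chart_mem_atlas E x
  set e := chartAt E x
  have hxs : x ∈ e.source := mem_chart_source E x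
  have h1 := higgs_eq_zero_of_coord (Q := coordEnd e Q) e.open_target
    (hI.harmonic.metric.smooth e he) (fun y _ => coordMetric_hermitian hI.harmonic.metric y)
    (fun y hy v hv => coordMetric_pos hpos he hy hv) (hI.harmonic.higgs.holomorphic e he)
    (hI.harmonic.integrable e he) (hD e he) (fun y hy v => by
      have h2 := hI.dPrime_U e he y hy v
      rw [hDU e he y hy v, zero_sub, neg_add_eq_zero] at h2
      exact h2) (e x) (e.map_source hxs)
  have h2 : Φ (e.symm (e x)) = 0 := by
    ext X Y
    apply coordAt_injective he (e.map_source hxs)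
    have h3 := DFunLike.congr_fun (DFunLike.congr_fun h1 (coordAt e (e x) X)) (coordAt e (e x) Y)
    change coordAt e (e x) (Φ _ (frameAt e (e x) (coordAt e (e x) X))
      (frameAt e (e x) (coordAt e (e x) Y))) = 0 at h3
    rw [frameAt_coordAt he (e.map_source hxs), frameAt_coordAt he (e.map_source hxs)] at h3
    rw [h3]
    exact (map_zero (coordAt e (e x))).symm
  rwa [e.left_inv hxs] at h2

end HarmonicBundles

end HarmonicHiggs

end

/-! ### The main theorem. -/

open HarmonicHiggs in
theorem theorem2 {E : Type*} [NormedAddCommGroup E] [NormedSpace ℂ E] [FiniteDimensional ℂ E]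
    {M : Type*} [TopologicalSpace M] [ChartedSpace E M] [IsManifold 𝓘(ℂ, E) ω M]
    (h : ∀ x : M, TangentSpace 𝓘(ℂ, E) x →L[ℂ] TangentSpace 𝓘(ℂ, E) x →L⋆[ℂ] ℂ)
    (Φ : ∀ x : M, TangentSpace 𝓘(ℂ, E) x →L[ℂ]
      TangentSpace 𝓘(ℂ, E) x →L[ℂ] TangentSpace 𝓘(ℂ, E) x)
    (U Q : ∀ x : M, TangentSpace 𝓘(ℂ, E) x →L[ℂ] TangentSpace 𝓘(ℂ, E) x)
    (hIHHB : HarmonicHiggs.IsIntegrableHarmonicHiggsBundle h Φ U Q)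
    (hpos : HarmonicHiggs.IsPositiveDefinite h)
    (hDU : HarmonicHiggs.DPrimeVanishes h U)
    (hD : HarmonicHiggs.IsHolomorphicDPrime h) :
    (∀ (x : M) (X Y : TangentSpace 𝓘(ℂ, E) x), HarmonicHiggs.higgsProduct Φ x X Y = 0) ∧
    (∀ x : M, Φ x = 0) ∧
    ((∀ x : M, U x = 0) →
      ∀ e ∈ atlas E M, ∀ p ∈ e.source,
        ∃ W : Set M, IsOpen W ∧ p ∈ W ∧ W ⊆ e.source ∧
        ∃ (b : ∀ x : M,
            Module.Basis (Fin (Module.finrank ℂ E)) ℂ (TangentSpace 𝓘(ℂ, E) x))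
          (l : Fin (Module.finrank ℂ E) → ℝ),
          (∀ i, DifferentiableOn ℂ (HarmonicHiggs.coordSection e fun x => b x i) (e '' W)) ∧
          (∀ i, ∀ y ∈ e '' W, ∀ v : E,
            HarmonicHiggs.dPrime (HarmonicHiggs.coordMetric e h)
              (HarmonicHiggs.coordSection e fun x => b x i) y v = 0) ∧
          (∀ x ∈ W, ∀ i, Q x (b x i) = (l i : ℂ) • b x i) ∧
          ∀ (w : ℂ) (s : ℂ → ∀ x : M, TangentSpace 𝓘(ℂ, E) x),
            ContDiffOn ℝ ∞ (HarmonicHiggs.coordPullSection e s) ({0}ᶜ ×ˢ (e '' W)) →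
            ∀ z : ℂ, z ≠ 0 → ∀ y ∈ e '' W, ∀ (a : ℂ) (v : E),
              HarmonicHiggs.structureConn w (HarmonicHiggs.coordMetric e h)
                  (HarmonicHiggs.coordHiggs e Φ) (HarmonicHiggs.coordEnd e U)
                  (HarmonicHiggs.coordEnd e Q) (HarmonicHiggs.coordPullSection e s) (z, y) (a, v)
                = HarmonicHiggs.pullDPrime (HarmonicHiggs.coordMetric e h)
                    (HarmonicHiggs.coordPullSection e s) (z, y) (a, v)
                  + (a / z) • HarmonicHiggs.coordAt e y
                      (Matrix.toLin (b (e.symm y)) (b (e.symm y))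
                        (-Matrix.diagonal (fun i => (l i : ℂ)) + (w / 2) • 1)
                        (s z (e.symm y)))) := by

  have hΦ := higgs_eq_zero hIHHB hpos hDU hD
  refine ⟨fun x X Y => ?_, hΦ, fun hU e he p hp => ?_⟩
  · rw [higgsProduct, hΦ x]
    exact neg_zero
  have hΦ0 := coordHiggs_zero (e := e) hΦ
  have hU0 := coordEnd_zero (e := e) hU
  -- With Φ = 0 the integrable connection is the Chern connection itself, which is therefore flat.
  have htot : totalForm (coordMetric e h) (coordHiggs e Φ) = chernForm (coordMetric e h) := by
    ext y v w
    simp [totalForm, hΦ0, adj_zero]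
  obtain ⟨r, hr, hball, b, l, hbd, hbD, hbQ⟩ := exists_flat_eigenframe_of_coord
    (Q := coordEnd e Q) e.open_target
    (hIHHB.harmonic.metric.smooth e he) (fun y _ => coordMetric_hermitian hIHHB.harmonic.metric y)
    (fun y hy v hv => coordMetric_pos hpos he hy hv)
    (fun y hy v w => by rw [← htot]; exact hIHHB.harmonic.integrable e he y hy v w)
    (hIHHB.smooth_Q e he)
    (fun y hy => coordMetric_selfAdjoint hIHHB.selfAdjoint_Q he hy)
    (fun y hy v => by
      have h1 := hIHHB.dPrime_Q e he y hy v
      rw [hΦ0] at h1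
      simpa using h1) (e.map_source hp)
  have himg : e '' (e.source ∩ e ⁻¹' Metric.ball (e p) r) = Metric.ball (e p) r := by
    refine Set.Subset.antisymm (Set.image_subset_iff.2 Set.inter_subset_right) fun y hy => ?_
    refine ⟨e.symm y, ⟨e.map_target (hball hy), ?_⟩, e.right_inv (hball hy)⟩
    rwa [Set.mem_preimage, e.right_inv (hball hy)]
  -- Having x = e.symm y as a hypothesis lets the basis be indexed by x itself. Off the chart domain
  -- any basis will do, and `b 0` is one.
  have hB : ∀ x : M, ∃ B : Module.Basis (Fin (Module.finrank ℂ E)) ℂ (TangentSpace 𝓘(ℂ, E) x),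
      ∀ y ∈ e.target, x = e.symm y → ∀ i, mfderiv 𝓘(ℂ, E) 𝓘(ℂ, E) e x (B i) = b y i := fun x => by
    by_cases hx : x ∈ e.source
    · have hB := exists_basis_coordAt he (e.map_source hx) (b (e x))
      rw [coordAt, e.left_inv hx] at hB
      obtain ⟨B, hB⟩ := hB
      refine ⟨B, fun y hy hxy i => (hB i).trans (congrArg (fun y => b y i) ?_)⟩
      rw [hxy, e.right_inv hy]
    · exact ⟨b 0, fun y hy hxy => absurd (hxy ▸ e.map_target hy) hx⟩
  choose B hB using hB
  have hBb : ∀ y ∈ e.target, ∀ i, coordAt e y (B (e.symm y) i) = b y i :=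
    fun y hy i => hB (e.symm y) y hy rfl i
  have hBQ : ∀ y ∈ Metric.ball (e p) r, ∀ i,
      Q (e.symm y) (B (e.symm y) i) = (l i : ℂ) • B (e.symm y) i := fun y hy i => by
    apply coordAt_injective he (hball hy)
    have h1 := hbQ y hy i
    rw [← hBb y (hball hy)] at h1
    change coordAt e y (Q _ (frameAt e y (coordAt e y (B (e.symm y) i)))) = _ at h1
    rw [frameAt_coordAt he (hball hy)] at h1
    rw [h1]
    exact (map_smul (coordAt e y) _ _).symm
  -- Equality of germs, since D' differentiates the section.
  have heq : ∀ i, ∀ y ∈ Metric.ball (e p) r,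
      (coordSection e fun x => B x i) =ᶠ[nhds y] fun y => b y i := fun i y hy => by
    filter_upwards [Metric.isOpen_ball.mem_nhds hy] with y' hy' using hBb y' (hball hy') i
  refine ⟨e.source ∩ e ⁻¹' Metric.ball (e p) r, e.isOpen_inter_preimage Metric.isOpen_ball,
    ⟨hp, Metric.mem_ball_self hr⟩, Set.inter_subset_left, B, l, ?_⟩
  rw [himg]
  refine ⟨fun i => (hbd i).congr fun y hy => (heq i y hy).self_of_nhds, fun i y hy v => ?_,
    fun x hx i => ?_, fun w s _ z hz y hy a v => ?_⟩
  · rw [← hbD i y hy v, dPrime, dPrime, del_congr (heq i y hy), (heq i y hy).self_of_nhds]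
  · have h1 := hBQ (e x) hx.2 i
    rwa [e.left_inv hx.1] at h1
  · have hQ : Matrix.toLin (B (e.symm y)) (B (e.symm y)) (Matrix.diagonal fun i => (l i : ℂ))
        = (Q (e.symm y)).toLinearMap := by
      refine (B (e.symm y)).ext fun i => ?_
      rw [Matrix.toLin_self]
      simp only [Matrix.diagonal_apply, ite_smul, zero_smul, Finset.sum_ite_eq', Finset.mem_univ,
        if_true]
      exact (hBQ y hy i).symm
    have hL : Matrix.toLin (B (e.symm y)) (B (e.symm y))
        (-Matrix.diagonal (fun i => (l i : ℂ)) + (w / 2) • 1) (s z (e.symm y))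
        = -Q _ (s z (e.symm y)) + (w / 2) • s z (e.symm y) := by
      rw [map_add, map_neg, map_smul, Matrix.toLin_one, hQ]
      rfl
    have hc : coordEnd e Q y (coordPullSection e s (z, y)) = coordAt e y (Q _ (s z (e.symm y))) :=
      congrArg (fun X => coordAt e y (Q (e.symm y) X)) (frameAt_coordAt he (hball hy) _)
    have hlin : ∀ X Y : TangentSpace 𝓘(ℂ, E) (e.symm y), coordAt e y (-X + (w / 2) • Y)
        = -coordAt e y X + (w / 2) • coordAt e y Y := fun X Y => by
      rw [map_add, map_neg, map_smul]
    rw [hL, hlin, ← hc]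
    simp only [structureConn, hΦ0, hU0, Pi.zero_apply, adj_zero, smul_zero, zero_apply, zero_sub,
      sub_zero, add_zero, add_apply, neg_apply, smul_apply, ContinuousLinearMap.id_apply]
    rfl
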